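/- **Definitions.** Let $K$ be an algebraically closed field and $K[[\mathbf x]]=K[[x_1,\dots,x_n]]$. * $f\sim_c g$ (contact equivalence) means $f=u\cdot\varphi(g)$ for some $\varphi\in\mathrm{Aut}_K(K[[\mathbf x]])$ and some unit $u\in K[[\mathbf x]]^*$. The series $f$ is *contact $k$-determined* if $f\sim_c g$ for every $g$ having the same terms of degree $\le k$ as $f$. The *contact determinacy* of $f$ is the least such $k$. * The *Newton diagram* $\Gamma(f)$ is the union of the compact faces of the convex hull of $\bigcup_{\alpha\in\operatorname{supp}(f)}(\alpha+\mathbb R_{\ge0}^n)$. * A *$C$-polytope* is a set $P=\{r\in\mathbb R^n_{\ge 0}\mid\lambda_P(r)=1\}$, where $\lambda_P(r)=\min_i w_i\cdot r$ for a finite nonempty set of vectors $w_i\in\mathbb Q_{>0}^n$ that is irredundant (each form $w_i\cdot r$ is strictly smaller than all the others somewhere on $\mathbb R^n_{\ge0}$). The $w_i$ are then determined by $P$. Let $N_P$ be the least common multiple of the denominators of the entries of the $w_i$. * For $f=\sum_\alpha a_\alpha\mathbf x^\alpha$ put $v_P(f)=\min\{N_P\lambda_P(\alpha)\mid a_\alpha\ne0\}$.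 For a $K$-derivation $\xi=\sum_{i,\alpha}a_{i,\alpha}\mathbf x^\alpha\partial_{x_i}$ of $K[[\mathbf x]]$ put $v_P(\xi)=\min\{N_P\lambda_P(\alpha-e_i)\mid a_{i,\alpha}\neq0\}$. In both cases $v_P(0)=\infty$. The *principal part* $\mathrm{In}_P(f)$ is the sum of those terms $a_\alpha\mathbf x^\alpha$ of $f$ for which $\lambda_P(\alpha)$ is minimal on $\operatorname{supp}(f)$. * $f$ *satisfies AC with respect to $P$* if for every nonzero $h$ in the Tjurina ideal $\langle f,\partial_{x_1}f,\dots,\partial_{x_n}f\rangle$ there are $g\in K[[\mathbf x]]$ and a $K$-derivation $\xi$ of $K[[\mathbf x]]$ with $$v_P(h)=\min\{v_P(g)+v_P(f),\,v_P(\xi)+v_P(f)\}<v_P(h-g f-\xi f).$$ **Corollary 5.3 (normal form of $T_{pq}$).** Let $K$ be an algebraically closed field with $\operatorname{char}K\neq2$, let $p,q$ be positive integers with $\frac1p+\frac1q<\frac12$, and let $0\ne\lambda\in K$. Let $f\in K[[x,y]]$ be a power series whose Newton diagram $P=\Gamma(f)$ is a $C$-polytope and whose principal part with respect to it is $$\mathrm{In}_{\Gamma(f)}(f)=x^p+\lambda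 x^2y^2+y^q .$$ Then $f$ satisfies AC with respect to $P=\Gamma(f)$, and $$f\;\sim_c\;x^p+\lambda x^2y^2+y^q .$$ Moreover, the contact determinacy of $f$ is exactly $\max\{p,q\}$. -/

import Mathlib

noncomputable section

namespace ContactSing

open MvPowerSeries

/-- Contact equivalence of power series: `f = u · φ(g)` with `φ` a `K`-algebra automorphism of
`K[[x_1,…,x_n]]` and `u` a unit. -/
def ContactEquiv {K : Type*} [Field K] {n : ℕ} (f g : MvPowerSeries (Fin n) K) : Prop :=
  ∃ (φ : MvPowerSeries (Fin n) K ≃ₐ[K] MvPowerSeries (Fin n) K)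
    (u : (MvPowerSeries (Fin n) K)ˣ), f = (u : MvPowerSeries (Fin n) K) * φ g

/-- `f` is contact `k`-determined: it is contact equivalent to every `g` having the same
coefficients as `f` in all degrees `≤ k`. -/
def ContactDetermined {K : Type*} [Field K] {n : ℕ} (k : ℕ) (f : MvPowerSeries (Fin n) K) :
    Prop :=
  ∀ g : MvPowerSeries (Fin n) K,
    (∀ α : Fin n →₀ ℕ, α.degree ≤ k → coeff α g = coeff α f) → ContactEquiv f g

/-- `d` is the contact determinacy of `f`: the least `k` such that `f` is contact
`k`-determined. -/
def HasContactDeterminacy {K : Type*} [Field K] {n : ℕ} (f : MvPowerSeries (Fin n) K) (d : ℕ) :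
    Prop :=
  IsLeast {k : ℕ | ContactDetermined k f} d

/-- The Tjurina ideal `⟨f, ∂f/∂x_1, …, ∂f/∂x_n⟩`. -/
def tjurinaIdeal {K : Type*} [Field K] {n : ℕ} (f : MvPowerSeries (Fin n) K) :
    Ideal (MvPowerSeries (Fin n) K) :=
  Ideal.span ({f} ∪ Set.range fun i : Fin n => pderiv K i f)

/-- The Newton polyhedron `Γ₊(f)`: the convex hull of the union of the sets `α + ℝ_{≥0}^n`,
`α ∈ supp f`. -/
def newtonPolyhedron {K : Type*} [Field K] {n : ℕ} (f : MvPowerSeries (Fin n) K) :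
    Set (Fin n → ℝ) :=
  convexHull ℝ {r : Fin n → ℝ | ∃ α : Fin n →₀ ℕ, coeff α f ≠ 0 ∧ ∀ j, (α j : ℝ) ≤ r j}

/-- The Newton diagram `Γ(f)`: the union of the compact faces of the Newton polyhedron. -/
def newtonDiagram {K : Type*} [Field K] {n : ℕ} (f : MvPowerSeries (Fin n) K) :
    Set (Fin n → ℝ) :=
  {r | ∃ A : Set (Fin n → ℝ), IsExposed ℝ (newtonPolyhedron f) A ∧ IsCompact A ∧ r ∈ A}

/-- A `C`-polytope in `ℝ_{≥0}^n`, given by the irredundant finite set of its weight vectors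
(the scaled inner normals of its facets), which have positive rational entries. Irredundant:
each of the linear forms is, somewhere on the orthant, strictly smaller than all the others. -/
structure CPolytope (n : ℕ) where
  weights : Finset (Fin n → ℚ)
  nonempty : weights.Nonempty
  pos : ∀ w ∈ weights, ∀ j, 0 < w j
  irredundant : ∀ w ∈ weights, ∃ r : Fin n → ℝ, (∀ j, 0 ≤ r j) ∧
    ∀ w' ∈ weights, w' ≠ w → ∑ j, (w j : ℝ) * r j < ∑ j, (w' j : ℝ) * r j

namespace CPolytope

variable {n : ℕ} (P : CPolytope n)

/-- The concave piecewise linear function `λ_P`, the minimum of the linear forms given by the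
weight vectors. -/
def lam (r : Fin n → ℝ) : ℝ :=
  P.weights.inf' P.nonempty fun w => ∑ j, (w j : ℝ) * r j

/-- The subset of `ℝ_{≥0}^n` underlying the `C`-polytope. -/
def carrier : Set (Fin n → ℝ) :=
  {r | (∀ j, 0 ≤ r j) ∧ P.lam r = 1}

/-- `N_P`: the least common multiple of the denominators of all entries of the weight vectors. -/
def denom : ℕ :=
  P.weights.lcm fun w => Finset.univ.lcm fun j => (w j).den

/-- The piecewise valuation `v_P(f) = min {N_P · λ_P(α) | α ∈ supp f}`, with `v_P(0) = ∞`. -/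
def val {K : Type*} [Field K] (f : MvPowerSeries (Fin n) K) : EReal :=
  ⨅ (α : Fin n →₀ ℕ) (_ : coeff α f ≠ 0),
    (((P.denom : ℝ) * P.lam (fun j => (α j : ℝ)) : ℝ) : EReal)

/-- The piecewise valuation of a derivation `ξ = ∑ a_{i,α} x^α ∂_{x_i}`, that is
`v_P(ξ) = min {N_P · λ_P(α - e_i) | a_{i,α} ≠ 0}`, with `v_P(0) = ∞`. Here `a_{i,α}` is the
coefficient of `x^α` in `ξ(x_i)`. -/
def derVal {K : Type*} [Field K]
    (ξ : Derivation K (MvPowerSeries (Fin n) K) (MvPowerSeries (Fin n) K)) : EReal :=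
  ⨅ (i : Fin n) (α : Fin n →₀ ℕ) (_ : coeff α (ξ (X i)) ≠ 0),
    (((P.denom : ℝ) * P.lam (fun j => (α j : ℝ) - if j = i then 1 else 0) : ℝ) : EReal)

open Classical in
/-- The principal part (initial form) `In_P(f)`: the sum of the terms of `f` whose exponent has
minimal `λ_P` among all exponents in the support of `f`. -/
def initialForm {K : Type*} [Field K] (f : MvPowerSeries (Fin n) K) :
    MvPowerSeries (Fin n) K :=
  fun α =>
    if ∀ β : Fin n →₀ ℕ, coeff β f ≠ 0 →
      P.lam (fun j => (α j : ℝ)) ≤ P.lam (fun j => (β j : ℝ))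
    then coeff α f else 0

/-- Condition AC with respect to `P`: for each nonzero `h` in the Tjurina ideal of `f` there are
a power series `g` and a derivation `ξ` with
`v_P(h) = min {v_P(g) + v_P(f), v_P(ξ) + v_P(f)} < v_P(h - g f - ξ f)`. -/
def SatisfiesAC {K : Type*} [Field K] (f : MvPowerSeries (Fin n) K) : Prop :=
  ∀ h ∈ tjurinaIdeal f, h ≠ 0 →
    ∃ (g : MvPowerSeries (Fin n) K)
      (ξ : Derivation K (MvPowerSeries (Fin n) K) (MvPowerSeries (Fin n) K)),
      P.val h = min (P.val g + P.val f) (P.derVal ξ + P.val f) ∧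
      min (P.val g + P.val f) (P.derVal ξ + P.val f) < P.val (h - g * f - ξ f)

end CPolytope

/-- The polynomial `x^p + c x^2 y^2 + y^q`, as a power series in `x = X 0` and `y = X 1`. -/
def tpq {K : Type*} [Field K] (p q : ℕ) (c : K) : MvPowerSeries (Fin 2) K :=
  X 0 ^ p + C c * X 0 ^ 2 * X 1 ^ 2 + X 1 ^ q

end ContactSing

end

/-! Write f₀ = x^p + λx²y² + y^q and d = 2pq. Monomials are measured by `tpqOrder`, the minimum of
two linear forms that equals d on the polygon with vertices (p,0), (2,2), (0,q). The condition 1/p +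
1/q < 1/2 says that (2,2) lies strictly below the segment joining the other two vertices. The order
is therefore superadditive, and a product of monomials strictly on opposite sides of the diagonal
gains order. This gain drives the proof.

Multiplication by x²y² raises every order by exactly d, while multiplication by y^q raises that of
x^a y^b with b < a by more than d. So in the cone b < a the derivative ∂f₀/∂y acts to leading order
like 2λx²y, and symmetrically ∂f₀/∂x acts like 2λxy² in the other cone. Pure powers come from f₀ -
(y/2)∂f₀/∂y = x^p + (1 - q/2)y^q and its mirror image. Only 2 and λ are inverted, so a
characteristic dividing p or q does no harm. Hence all series of order above d are tangent to f₀ to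
leading order (`orderFil_le_leadingTangent_of_sub_tpq_mem`).

Normal form: successive corrections of a unit and of two coordinates converge
(`IsTpqApprox.exists_step`), and the resulting substitution is an automorphism
(`exists_algEquiv_of_sub_mem_orderFil`). AC: above order d use the tangency; up to order d leading
parts cannot cancel (`coefficients_mem_orderFil_of_le`). Determinacy: monomials of degree above
max(p,q) lie above the polygon, while f₀ - x^p and f₀ - y^q have square factors and f₀ has none
(`not_prime_dvd_tpq_and_pderiv`).

The assumption on the Newton diagram enters through convexity: `lam_eq` identifies λ_P with the
order on the whole plane. The negative exponents are needed for derivations, and there irredundancy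
of the weights is decisive. -/

noncomputable section

namespace ContactSing

open MvPowerSeries

/-! ### Order filtrations on K[[x,y]], limits, and order-raising substitutions. -/

section

/-- A superadditive function on the exponent lattice that is nonnegative on the positive
quadrant, as used to measure the order of series and of derivations in two variables. -/
structure IsPlaneOrder (l : ℤ → ℤ → ℤ) : Prop where
  add_le : ∀ a b a' b', l a b + l a' b' ≤ l (a + a') (b + b')
  nonneg : ∀ a b, 0 ≤ a → 0 ≤ b → 0 ≤ l a b
  neg_left : l (-1) 0 ≤ 0
  neg_right : l 0 (-1) ≤ 0

variable {K : Type*} [Field K] {l : ℤ → ℤ → ℤ}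

/-- The series all of whose exponents `α` satisfy `t ≤ l (α - (i, j))`. -/
def orderFil (K : Type*) [Field K] (l : ℤ → ℤ → ℤ) (i j t : ℤ) :
    Submodule K (MvPowerSeries (Fin 2) K) where
  carrier := {h | ∀ α, coeff α h ≠ 0 → t ≤ l (α 0 - i) (α 1 - j)}
  zero_mem' := fun α h => absurd (coeff_zero α) h
  add_mem' := by
    intro a b ha hb α h
    by_cases h1 : coeff α a = 0
    · exact hb α fun h2 => h (by rw [map_add, h1, h2, add_zero])
    · exact ha α h1
  smul_mem' := by
    intro c a ha α h
    exact ha α fun h1 => h (by rw [coeff_smul, h1, mul_zero])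

theorem coeff_eq_zero_of_mem_orderFil {i j t : ℤ} {h : MvPowerSeries (Fin 2) K}
    (hh : h ∈ orderFil K l i j t) {α : Fin 2 →₀ ℕ} (hα : l (α 0 - i) (α 1 - j) < t) :
    coeff α h = 0 := by
  by_contra h0
  exact absurd (hh α h0) (not_le.2 hα)

theorem orderFil_mono {i j s t : ℤ} (hst : s ≤ t) : orderFil K l i j t ≤ orderFil K l i j s :=
  fun _ hh α hα => hst.trans (hh α hα)

theorem orderFil_shift (hl : IsPlaneOrder l) {i j i' j' t t' : ℤ}
    (ht : t' ≤ t + l (i - i') (j - j')) : orderFil K l i j t ≤ orderFil K l i' j' t' := by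
  intro h hh α hα
  have h1 := hh α hα
  have h2 := hl.add_le (α 0 - i) (α 1 - j) (i - i') (j - j')
  rw [sub_add_sub_cancel, sub_add_sub_cancel] at h2
  linarith

theorem mul_mem_orderFil (hl : IsPlaneOrder l) {i j i' j' s t : ℤ}
    {a b : MvPowerSeries (Fin 2) K} (ha : a ∈ orderFil K l i j s)
    (hb : b ∈ orderFil K l i' j' t) : a * b ∈ orderFil K l (i + i') (j + j') (s + t) := by
  intro α hα
  rw [coeff_mul] at hα
  obtain ⟨⟨β, γ⟩, h1, h2⟩ := Finset.exists_ne_zero_of_sum_ne_zero hα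
  rw [Finset.HasAntidiagonal.mem_antidiagonal] at h1
  dsimp only at h1 h2
  have h3 := ha β (left_ne_zero_of_mul h2)
  have h4 := hb γ (right_ne_zero_of_mul h2)
  have h5 := hl.add_le (β 0 - i) (β 1 - j) (γ 0 - i') (γ 1 - j')
  subst h1
  simp only [Finsupp.add_apply, Nat.cast_add]
  rw [add_sub_add_comm, add_sub_add_comm]
  linarith

theorem mul_mem_orderFil' (hl : IsPlaneOrder l) {i j i' j' s t i'' j'' t'' : ℤ}
    {a b : MvPowerSeries (Fin 2) K} (ha : a ∈ orderFil K l i j s)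
    (hb : b ∈ orderFil K l i' j' t) (hi : i + i' = i'' := by ring) (hj : j + j' = j'' := by ring)
    (ht : t'' ≤ s + t := by linarith) : a * b ∈ orderFil K l i'' j'' t'' := by
  subst hi hj
  exact orderFil_mono ht (mul_mem_orderFil hl ha hb)

theorem monomial_mem_orderFil {i j t : ℤ} {α : Fin 2 →₀ ℕ} (r : K)
    (h : t ≤ l (α 0 - i) (α 1 - j)) : monomial α r ∈ orderFil K l i j t := by
  intro β hβ
  rwa [eq_of_coeff_monomial_ne_zero hβ]

theorem mem_orderFil_zero (hl : IsPlaneOrder l) (h : MvPowerSeries (Fin 2) K) :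
    h ∈ orderFil K l 0 0 0 := by
  intro α _
  exact hl.nonneg _ _ (by simp) (by simp)

theorem X_zero_mem_orderFil (hl : IsPlaneOrder l) :
    (X 0 : MvPowerSeries (Fin 2) K) ∈ orderFil K l 1 0 0 :=
  monomial_mem_orderFil _ (hl.nonneg _ _ (by simp) (by simp))

theorem X_one_mem_orderFil (hl : IsPlaneOrder l) :
    (X 1 : MvPowerSeries (Fin 2) K) ∈ orderFil K l 0 1 0 :=
  monomial_mem_orderFil _ (hl.nonneg _ _ (by simp) (by simp))

theorem pow_mem_orderFil (hl : IsPlaneOrder l) {i j : ℤ} {a : MvPowerSeries (Fin 2) K}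
    (ha : a ∈ orderFil K l i j 0) (n : ℕ) : a ^ n ∈ orderFil K l (n * i) (n * j) 0 := by
  induction n with
  | zero => simpa using mem_orderFil_zero hl 1
  | succ n ih =>
    rw [pow_succ]
    exact mul_mem_orderFil' hl ih ha (by push_cast; ring) (by push_cast; ring)

theorem pderiv_zero_mem_orderFil {i j t : ℤ} {a : MvPowerSeries (Fin 2) K}
    (ha : a ∈ orderFil K l i j t) : pderiv K 0 a ∈ orderFil K l (i - 1) j t := by
  intro α hα
  rw [coeff_pderiv] at hα
  have := ha _ (left_ne_zero_of_mul hα)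
  simp only [Finsupp.add_apply, Finsupp.single_apply] at this
  convert this using 2 <;> simp [sub_sub_eq_add_sub]

theorem pderiv_one_mem_orderFil {i j t : ℤ} {a : MvPowerSeries (Fin 2) K}
    (ha : a ∈ orderFil K l i j t) : pderiv K 1 a ∈ orderFil K l i (j - 1) t := by
  intro α hα
  rw [coeff_pderiv] at hα
  have := ha _ (left_ne_zero_of_mul hα)
  simp only [Finsupp.add_apply, Finsupp.single_apply] at this
  convert this using 2 <;> simp [sub_sub_eq_add_sub]

theorem eq_zero_of_forall_mem_orderFil {i j : ℤ} {a : MvPowerSeries (Fin 2) K}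
    (ha : ∀ k : ℕ, a ∈ orderFil K l i j k) : a = 0 := by
  ext α
  refine coeff_eq_zero_of_mem_orderFil (ha (l (α 0 - i) (α 1 - j) + 1).toNat) ?_
  have := Int.self_le_toNat (l (α 0 - i) (α 1 - j) + 1)
  linarith

theorem sub_mem_orderFil_of_step {i j : ℤ} {a : ℕ → MvPowerSeries (Fin 2) K}
    (ha : ∀ k : ℕ, a (k + 1) - a k ∈ orderFil K l i j k) {k m : ℕ} (hkm : k ≤ m) :
    a m - a k ∈ orderFil K l i j k := by
  induction m, hkm using Nat.le_induction with
  | base => simp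
  | succ m hm ih =>
    rw [← sub_add_sub_cancel]
    exact add_mem (orderFil_mono (by exact_mod_cast hm) (ha m)) ih

/-- Sequences with rapidly vanishing increments converge. -/
theorem exists_limit_orderFil {i j : ℤ} {a : ℕ → MvPowerSeries (Fin 2) K}
    (ha : ∀ k : ℕ, a (k + 1) - a k ∈ orderFil K l i j k) :
    ∃ b, ∀ k : ℕ, b - a k ∈ orderFil K l i j k := by
  -- From index `N α` on, the increments have order beyond that of `α`, so the coefficient at `α` is
  -- stationary.
  let N : (Fin 2 →₀ ℕ) → ℕ := fun α => (l (α 0 - i) (α 1 - j) + 1).toNat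
  obtain ⟨b, hb⟩ : ∃ b : MvPowerSeries (Fin 2) K, ∀ α, coeff α b = coeff α (a (N α)) :=
    ⟨fun α => coeff α (a (N α)), fun _ => rfl⟩
  refine ⟨b, fun k α hα => ?_⟩
  by_contra hlt
  rw [not_le] at hlt
  apply hα
  have hN : N α ≤ k := by
    simp only [N]
    omega
  have h0 : coeff α (a k - a (N α)) = 0 := by
    refine coeff_eq_zero_of_mem_orderFil (sub_mem_orderFil_of_step ha hN) ?_
    have := Int.self_le_toNat (l (α 0 - i) (α 1 - j) + 1)
    simp only [N]
    linarith
  rw [map_sub] at h0 ⊢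
  rw [hb, sub_eq_zero.1 h0, sub_self]

theorem mul_sub_mul_mem_orderFil (hl : IsPlaneOrder l) {i j i' j' s : ℤ}
    {a a' b b' : MvPowerSeries (Fin 2) K} (ha : a ∈ orderFil K l i j 0)
    (haa : a' - a ∈ orderFil K l i j s) (hb : b' ∈ orderFil K l i' j' 0)
    (hbb : b' - b ∈ orderFil K l i' j' s) :
    a' * b' - a * b ∈ orderFil K l (i + i') (j + j') s := by
  rw [show a' * b' - a * b = (a' - a) * b' + a * (b' - b) by ring]
  exact add_mem (mul_mem_orderFil' hl haa hb) (mul_mem_orderFil' hl ha hbb)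

theorem pow_sub_pow_mem_orderFil (hl : IsPlaneOrder l) {i j s : ℤ} (hs : 0 ≤ s)
    {a a' : MvPowerSeries (Fin 2) K} (ha : a ∈ orderFil K l i j 0)
    (haa : a' - a ∈ orderFil K l i j s) (n : ℕ) :
    a' ^ n - a ^ n ∈ orderFil K l (n * i) (n * j) s := by
  have ha' : a' ∈ orderFil K l i j 0 := by
    simpa using add_mem (orderFil_mono hs haa) ha
  induction n with
  | zero => simp
  | succ n ih =>
    have := mul_sub_mul_mem_orderFil hl (pow_mem_orderFil hl ha n) ih ha' haa
    rw [pow_succ, pow_succ]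
    convert this using 2 <;> push_cast <;> ring

theorem pow_mul_pow_sub_mem_orderFil (hl : IsPlaneOrder l) {s : ℤ} (hs : 0 ≤ s)
    {a a' b b' : MvPowerSeries (Fin 2) K} (ha : a ∈ orderFil K l 1 0 0)
    (haa : a' - a ∈ orderFil K l 1 0 s) (hb : b ∈ orderFil K l 0 1 0)
    (hbb : b' - b ∈ orderFil K l 0 1 s) (m n : ℕ) :
    a' ^ m * b' ^ n - a ^ m * b ^ n ∈ orderFil K l m n s := by
  have hb' : b' ∈ orderFil K l 0 1 0 := by
    simpa using add_mem (orderFil_mono hs hbb) hb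
  have := mul_sub_mul_mem_orderFil hl (pow_mem_orderFil hl ha m)
    (pow_sub_pow_mem_orderFil hl hs ha haa m) (pow_mem_orderFil hl hb' n)
    (pow_sub_pow_mem_orderFil hl hs hb hbb n)
  convert this using 2 <;> ring

/-- A constant term would have relative order l(-1,0) ≤ 0 or l(0,-1) ≤ 0, below the required 1. -/
theorem constantCoeff_eq_zero_of_sub_mem_orderFil (hl : IsPlaneOrder l)
    {a : Fin 2 → MvPowerSeries (Fin 2) K} (h0 : a 0 - X 0 ∈ orderFil K l 1 0 1)
    (h1 : a 1 - X 1 ∈ orderFil K l 0 1 1) (s : Fin 2) : constantCoeff (a s) = 0 := by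
  have e0 : coeff 0 (a 0 - X 0) = 0 := by
    refine coeff_eq_zero_of_mem_orderFil h0 ?_
    simpa using lt_of_le_of_lt hl.neg_left zero_lt_one
  have e1 : coeff 0 (a 1 - X 1) = 0 := by
    refine coeff_eq_zero_of_mem_orderFil h1 ?_
    simpa using lt_of_le_of_lt hl.neg_right zero_lt_one
  rw [map_sub, coeff_zero_X, sub_zero, coeff_zero_eq_constantCoeff_apply] at e0 e1
  fin_cases s
  · exact e0
  · exact e1

theorem hasSubst_of_sub_mem_orderFil (hl : IsPlaneOrder l)
    {a : Fin 2 → MvPowerSeries (Fin 2) K} (h0 : a 0 - X 0 ∈ orderFil K l 1 0 1)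
    (h1 : a 1 - X 1 ∈ orderFil K l 0 1 1) : HasSubst a :=
  hasSubst_of_constantCoeff_zero (constantCoeff_eq_zero_of_sub_mem_orderFil hl h0 h1)

/-- Each monomial x^m y^n changes by terms of order at least 1 relative to (m,n); superadditivity
adds this to the order of the monomial itself. -/
theorem subst_sub_mem_orderFil (hl : IsPlaneOrder l)
    {a : Fin 2 → MvPowerSeries (Fin 2) K} (h0 : a 0 - X 0 ∈ orderFil K l 1 0 1)
    (h1 : a 1 - X 1 ∈ orderFil K l 0 1 1) {t : ℤ} {h : MvPowerSeries (Fin 2) K}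
    (hh : h ∈ orderFil K l 0 0 t) : subst a h - h ∈ orderFil K l 0 0 (t + 1) := by
  intro α hα
  have ha := hasSubst_of_sub_mem_orderFil hl h0 h1
  by_contra hlt
  rw [not_le] at hlt
  apply hα
  have hX : coeff α h = coeff α (subst (X : Fin 2 → MvPowerSeries (Fin 2) K) h) := by
    rw [subst_self, id]
  rw [map_sub, hX, coeff_subst ha, coeff_subst HasSubst.X,
    ← finsum_sub_distrib (coeff_subst_finite ha h α) (coeff_subst_finite HasSubst.X h α)]
  refine (finsum_congr fun d => ?_).trans finsum_zero
  rw [← smul_sub, ← map_sub]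
  by_cases hd : coeff d h = 0
  · rw [hd, zero_smul]
  · have hd1 := hh d hd
    rw [Finsupp.prod_fintype _ _ (by simp), Finsupp.prod_fintype _ _ (by simp),
      Fin.prod_univ_two, Fin.prod_univ_two]
    rw [coeff_eq_zero_of_mem_orderFil (pow_mul_pow_sub_mem_orderFil hl zero_le_one
      (X_zero_mem_orderFil hl) h0 (X_one_mem_orderFil hl) h1 (d 0) (d 1)), smul_zero]
    by_contra hge
    rw [not_lt] at hge
    have := hl.add_le (α 0 - d 0) (α 1 - d 1) (d 0) (d 1)
    simp only [sub_add_cancel, sub_zero] at this hd1 hlt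
    linarith

/-- Substitutions that raise the order of the coordinate changes are automorphisms. -/
theorem exists_algEquiv_of_sub_mem_orderFil (hl : IsPlaneOrder l)
    {x y : MvPowerSeries (Fin 2) K} (h0 : x - X 0 ∈ orderFil K l 1 0 1)
    (h1 : y - X 1 ∈ orderFil K l 0 1 1) :
    ∃ φ : MvPowerSeries (Fin 2) K ≃ₐ[K] MvPowerSeries (Fin 2) K, φ (X 0) = x ∧ φ (X 1) = y := by
  set a : Fin 2 → MvPowerSeries (Fin 2) K := ![x, y] with ha
  have h0' : a 0 - X 0 ∈ orderFil K l 1 0 1 := h0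
  have h1' : a 1 - X 1 ∈ orderFil K l 0 1 1 := h1
  have hs := hasSubst_of_sub_mem_orderFil hl h0' h1'
  set φ : MvPowerSeries (Fin 2) K →ₐ[K] MvPowerSeries (Fin 2) K := substAlgHom hs with hφ
  have hsub : ∀ {t : ℤ} {h}, h ∈ orderFil K l 0 0 t → φ h - h ∈ orderFil K l 0 0 (t + 1) := by
    intro t h hh
    rw [hφ, substAlgHom_apply]
    exact subst_sub_mem_orderFil hl h0' h1' hh
  have hmem : ∀ {t : ℤ} {h}, h ∈ orderFil K l 0 0 t → φ h ∈ orderFil K l 0 0 t := by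
    intro t h hh
    simpa using add_mem (orderFil_mono (by linarith) (hsub hh)) hh
  -- `φ` is the identity plus an order-raising map, so an element of the kernel has arbitrarily high
  -- order.
  have hinj : Function.Injective φ := by
    rw [injective_iff_map_eq_zero]
    intro h hh
    refine eq_zero_of_forall_mem_orderFil (l := l) (i := 0) (j := 0) fun k => ?_
    induction k with
    | zero => exact mem_orderFil_zero hl h
    | succ k ih =>
      have := hsub ih
      rw [hh, zero_sub, neg_mem_iff] at this
      exact_mod_cast this
  have hsurj : Function.Surjective φ := by
    intro h
    -- Adding the defect to the approximate preimage raises the order of the defect by one.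
    let b : ℕ → MvPowerSeries (Fin 2) K := fun k => Nat.rec 0 (fun _ c => c + (h - φ c)) k
    have hb : ∀ k : ℕ, h - φ (b k) ∈ orderFil K l 0 0 k := by
      intro k
      induction k with
      | zero => exact mem_orderFil_zero hl _
      | succ k ih =>
        have e : h - φ (b (k + 1)) = -(φ (h - φ (b k)) - (h - φ (b k))) := by
          have : b (k + 1) = b k + (h - φ (b k)) := rfl
          rw [this, map_add]
          ring
        rw [e, neg_mem_iff]
        exact_mod_cast hsub ih
    obtain ⟨c, hc⟩ := exists_limit_orderFil (l := l) (i := 0) (j := 0) (a := b) (fun k => by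
      have : b (k + 1) - b k = h - φ (b k) := add_sub_cancel_left _ _
      rw [this]
      exact hb k)
    refine ⟨c, (sub_eq_zero.1 ?_).symm⟩
    refine eq_zero_of_forall_mem_orderFil (l := l) (i := 0) (j := 0) fun k => ?_
    have : h - φ c = (h - φ (b k)) - φ (c - b k) := by rw [map_sub]; ring
    rw [this]
    exact sub_mem (hb k) (hmem (hc k))
  have hbij : Function.Bijective φ := ⟨hinj, hsurj⟩
  exact ⟨AlgEquiv.ofBijective φ hbij, substAlgHom_X hs 0, substAlgHom_X hs 1⟩

end

/-! ### Monomials, and the tangent space modulo higher order. -/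

section

variable {K : Type*} [Field K] {l : ℤ → ℤ → ℤ}

/-- The term `r x^a y^b`. -/
def term (a b : ℕ) (r : K) : MvPowerSeries (Fin 2) K :=
  monomial (Finsupp.single 0 a + Finsupp.single 1 b) r

theorem single_add_single_apply_zero (a b : ℕ) :
    (Finsupp.single 0 a + Finsupp.single 1 b : Fin 2 →₀ ℕ) 0 = a := by simp

theorem single_add_single_apply_one (a b : ℕ) :
    (Finsupp.single 0 a + Finsupp.single 1 b : Fin 2 →₀ ℕ) 1 = b := by simp

theorem single_add_single_eq (α : Fin 2 →₀ ℕ) :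
    Finsupp.single 0 (α 0) + Finsupp.single 1 (α 1) = α := by
  ext i
  fin_cases i <;> simp

theorem single_add_single_le {a b : ℕ} {α : Fin 2 →₀ ℕ} :
    Finsupp.single 0 a + Finsupp.single 1 b ≤ α ↔ a ≤ α 0 ∧ b ≤ α 1 := by
  rw [Finsupp.le_def, Fin.forall_fin_two, single_add_single_apply_zero,
    single_add_single_apply_one]

theorem coeff_term (α : Fin 2 →₀ ℕ) (a b : ℕ) (r : K) :
    coeff α (term a b r) = if α 0 = a ∧ α 1 = b then r else 0 := by
  rw [term, coeff_monomial]
  refine if_congr ⟨?_, ?_⟩ rfl rfl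
  · rintro rfl
    simp
  · rintro ⟨rfl, rfl⟩
    exact (single_add_single_eq α).symm

theorem coeff_mul_term (α : Fin 2 →₀ ℕ) (a b : ℕ) (r : K) (h : MvPowerSeries (Fin 2) K) :
    coeff α (h * term a b r) = if a ≤ α 0 ∧ b ≤ α 1 then
      coeff (Finsupp.single 0 (α 0 - a) + Finsupp.single 1 (α 1 - b)) h * r else 0 := by
  rw [term, coeff_mul_monomial]
  refine if_congr single_add_single_le ?_ rfl
  congr 3
  rw [← single_add_single_eq (α - _)]
  simp

theorem term_mul_term (a b a' b' : ℕ) (r s : K) :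
    term a b r * term a' b' s = term (a + a') (b + b') (r * s) := by
  rw [term, term, monomial_mul_monomial, term, Finsupp.single_add, Finsupp.single_add]
  congr 1
  abel_nf

theorem term_add_term (a b : ℕ) (r s : K) : term a b r + term a b s = term a b (r + s) :=
  (map_add _ r s).symm

theorem smul_term (a b : ℕ) (r s : K) : r • term a b s = term a b (r * s) :=
  (map_smul (monomial _) r s).symm

theorem term_zero (a b : ℕ) : term a b (0 : K) = 0 := map_zero _

theorem term_mem_orderFil {i j t : ℤ} (a b : ℕ) (r : K) (h : t ≤ l (a - i) (b - j)) :
    term a b r ∈ orderFil K l i j t := by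
  refine monomial_mem_orderFil _ ?_
  rwa [single_add_single_apply_zero, single_add_single_apply_one]

theorem pderiv_zero_term (a b : ℕ) (r : K) :
    pderiv K 0 (term a b r) = term (a - 1) b (r * a) := by
  ext α
  rw [coeff_pderiv, coeff_term, coeff_term]
  simp only [Finsupp.add_apply, Finsupp.single_eq_same]
  rcases a with _ | a
  · simp
  · simp +contextual [ite_and]

theorem pderiv_one_term (a b : ℕ) (r : K) :
    pderiv K 1 (term a b r) = term a (b - 1) (r * b) := by
  ext α
  rw [coeff_pderiv, coeff_term, coeff_term]
  simp only [Finsupp.add_apply, Finsupp.single_eq_same]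
  rcases b with _ | b
  · simp
  · simp +contextual [ite_and]

theorem X_pow_eq_term_zero (n : ℕ) : (X 0 : MvPowerSeries (Fin 2) K) ^ n = term n 0 1 := by
  rw [X_pow_eq, term, Finsupp.single_zero, add_zero]

theorem X_pow_eq_term_one (n : ℕ) : (X 1 : MvPowerSeries (Fin 2) K) ^ n = term 0 n 1 := by
  rw [X_pow_eq, term, Finsupp.single_zero, zero_add]

theorem tpq_eq_term (p q : ℕ) (c : K) : tpq p q c = term p 0 1 + term 2 2 c + term 0 q 1 := by
  rw [tpq, X_pow_eq_term_zero, X_pow_eq_term_zero, X_pow_eq_term_one, X_pow_eq_term_one, mul_assoc,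
    term_mul_term, ← smul_eq_C_mul, smul_term, mul_one, mul_one, zero_add, add_zero]

theorem pderiv_zero_tpq (p q : ℕ) (c : K) :
    pderiv K 0 (tpq p q c) = term (p - 1) 0 (p : K) + term 1 2 (2 * c) := by
  rw [tpq_eq_term, map_add, map_add, pderiv_zero_term, pderiv_zero_term, pderiv_zero_term]
  simp [term_zero, mul_comm]

theorem pderiv_one_tpq (p q : ℕ) (c : K) :
    pderiv K 1 (tpq p q c) = term 2 1 (2 * c) + term 0 (q - 1) (q : K) := by
  rw [tpq_eq_term, map_add, map_add, pderiv_one_term, pderiv_one_term, pderiv_one_term]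
  simp [term_zero, mul_comm]

/-- The elements of order `t` whose leading part of order `t` is a combination of `f` and its
partial derivatives with coefficients of order `t - d`. -/
def leadingTangent (l : ℤ → ℤ → ℤ) (d : ℤ) (f : MvPowerSeries (Fin 2) K) (t : ℤ) :
    Submodule K (MvPowerSeries (Fin 2) K) where
  carrier := {h | ∃ g ∈ orderFil K l 0 0 (t - d), ∃ a ∈ orderFil K l 1 0 (t - d),
    ∃ b ∈ orderFil K l 0 1 (t - d),
      h - (g * f + a * pderiv K 0 f + b * pderiv K 1 f) ∈ orderFil K l 0 0 (t + 1)}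
  zero_mem' := ⟨0, zero_mem _, 0, zero_mem _, 0, zero_mem _, by simp⟩
  add_mem' := by
    rintro h h' ⟨g, hg, a, ha, b, hb, e⟩ ⟨g', hg', a', ha', b', hb', e'⟩
    refine ⟨g + g', add_mem hg hg', a + a', add_mem ha ha', b + b', add_mem hb hb', ?_⟩
    convert add_mem e e' using 1
    ring
  smul_mem' := by
    rintro r h ⟨g, hg, a, ha, b, hb, e⟩
    refine ⟨r • g, Submodule.smul_mem _ _ hg, r • a, Submodule.smul_mem _ _ ha, r • b,
      Submodule.smul_mem _ _ hb, ?_⟩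
    convert Submodule.smul_mem _ r e using 1
    simp only [smul_mul_assoc, smul_add, smul_sub]

section leadingTangent

variable {d t : ℤ} {f h : MvPowerSeries (Fin 2) K}

theorem orderFil_le_leadingTangent : orderFil K l 0 0 (t + 1) ≤ leadingTangent l d f t :=
  fun h hh => ⟨0, zero_mem _, 0, zero_mem _, 0, zero_mem _, by simpa using hh⟩

theorem mul_mem_leadingTangent {g : MvPowerSeries (Fin 2) K}
    (hg : g ∈ orderFil K l 0 0 (t - d)) : g * f ∈ leadingTangent l d f t :=
  ⟨g, hg, 0, zero_mem _, 0, zero_mem _, by simp⟩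

theorem mul_pderiv_zero_mem_leadingTangent {g : MvPowerSeries (Fin 2) K}
    (hg : g ∈ orderFil K l 1 0 (t - d)) : g * pderiv K 0 f ∈ leadingTangent l d f t :=
  ⟨0, zero_mem _, g, hg, 0, zero_mem _, by simp⟩

theorem mul_pderiv_one_mem_leadingTangent {g : MvPowerSeries (Fin 2) K}
    (hg : g ∈ orderFil K l 0 1 (t - d)) : g * pderiv K 1 f ∈ leadingTangent l d f t :=
  ⟨0, zero_mem _, 0, zero_mem _, g, hg, by simp⟩

/-- The same coefficients serve for `f'`: replacing `f` changes the combination only beyond order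
`t`. -/
theorem leadingTangent_le_of_sub_mem (hl : IsPlaneOrder l) {f' : MvPowerSeries (Fin 2) K}
    (hf : f' - f ∈ orderFil K l 0 0 (d + 1)) : leadingTangent l d f t ≤ leadingTangent l d f' t := by
  rintro h ⟨g, hg, a, ha, b, hb, e⟩
  refine ⟨g, hg, a, ha, b, hb, ?_⟩
  have e0 := mul_mem_orderFil' hl (i'' := 0) (j'' := 0) (t'' := t + 1) hg hf
  have e1 := mul_mem_orderFil' hl (i'' := 0) (j'' := 0) (t'' := t + 1) ha
    (pderiv_zero_mem_orderFil hf)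
  have e2 := mul_mem_orderFil' hl (i'' := 0) (j'' := 0) (t'' := t + 1) hb
    (pderiv_one_mem_orderFil hf)
  convert sub_mem e (add_mem (add_mem e0 e1) e2) using 1
  rw [map_sub, map_sub]
  ring

theorem orderFil_le_of_term_mem (hlin : ∀ a b : ℕ, (a + b : ℤ) ≤ l a b)
    (V : Submodule K (MvPowerSeries (Fin 2) K)) (hV : orderFil K l 0 0 (t + 1) ≤ V)
    (hterm : ∀ a b : ℕ, l a b = t → term a b (1 : K) ∈ V) : orderFil K l 0 0 t ≤ V := by
  classical
  intro h hh
  -- By `hlin` an exponent outside this box has order above `t`, so only finitely many monomials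
  -- matter.
  set S : Finset (Fin 2 →₀ ℕ) :=
    Finset.Iic (Finsupp.single 0 t.toNat + Finsupp.single 1 t.toNat) with hS
  have hsum : ∑ α ∈ S, monomial α (coeff α h) ∈ V := by
    refine sum_mem fun α _ => ?_
    by_cases h0 : coeff α h = 0
    · rw [h0, map_zero]
      exact zero_mem _
    have h1 := hh α h0
    rw [sub_zero, sub_zero] at h1
    rcases h1.eq_or_lt with h2 | h2
    · have := Submodule.smul_mem V (coeff α h) (hterm _ _ h2.symm)
      rwa [smul_term, mul_one, term, single_add_single_eq] at this
    · refine hV (monomial_mem_orderFil _ ?_)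
      rw [sub_zero, sub_zero]
      exact h2
  have hrest : h - ∑ α ∈ S, monomial α (coeff α h) ∈ orderFil K l 0 0 (t + 1) := by
    intro β hβ
    rw [map_sub, map_sum] at hβ
    simp only [coeff_monomial, Finset.sum_ite_eq] at hβ
    have hβS : β ∉ S := fun hmem => hβ (by rw [if_pos hmem, sub_self])
    rw [hS, Finset.mem_Iic, ← single_add_single_eq β, single_add_single_le,
      single_add_single_apply_zero, single_add_single_apply_one] at hβS
    have := hlin (β 0) (β 1)
    rw [sub_zero, sub_zero]
    omega
  simpa using add_mem (hV hrest) hsum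

end leadingTangent

/-! ### The piecewise linear order of the polygon and its behaviour on the two cones. -/

/-- The order function of the Newton polygon with vertices `(p, 0)`, `(2, 2)`, `(0, q)`, scaled
so that its value on the polygon is `2 p q`. -/
def tpqOrder (p q : ℕ) (a b : ℤ) : ℤ :=
  min (2 * q * a + q * (p - 2) * b) (p * (q - 2) * a + 2 * p * b)

section tpqOrder

variable {p q : ℕ}

theorem three_le_left_of_lt (h : 2 * (p + q) < p * q) : 3 ≤ p := by
  by_contra! h1
  interval_cases p <;> omega

theorem three_le_right_of_lt (h : 2 * (p + q) < p * q) : 3 ≤ q :=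
  three_le_left_of_lt (q := p) (by linarith [mul_comm p q])

theorem isPlaneOrder_tpqOrder (h : 2 * (p + q) < p * q) : IsPlaneOrder (tpqOrder p q) where
  add_le a b a' b' := by
    refine le_min ?_ ?_
    · refine (add_le_add (min_le_left _ _) (min_le_left _ _)).trans (le_of_eq ?_)
      ring
    · refine (add_le_add (min_le_right _ _) (min_le_right _ _)).trans (le_of_eq ?_)
      ring
  nonneg a b ha hb := by
    have hp : (0 : ℤ) ≤ p - 2 := by have := three_le_left_of_lt h; omega
    have hq : (0 : ℤ) ≤ q - 2 := by have := three_le_right_of_lt h; omega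
    exact le_min (by positivity) (by positivity)
  neg_left := by
    refine (min_le_left _ _).trans ?_
    linarith [Int.natCast_nonneg q]
  neg_right := by
    refine (min_le_right _ _).trans ?_
    linarith [Int.natCast_nonneg p]

theorem cast_lt_of_lt (h : 2 * (p + q) < p * q) : (0 : ℤ) < p * q - 2 * p - 2 * q := by
  have : (2 * (p + q) : ℤ) < p * q := by exact_mod_cast h
  linarith

/-- The second form minus the first is (pq - 2p - 2q)(a - b), so the diagonal separates the two
domains of linearity. -/
theorem tpqOrder_of_le (h : 2 * (p + q) < p * q) {a b : ℤ} (hab : b ≤ a) :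
    tpqOrder p q a b = 2 * q * a + q * (p - 2) * b := by
  refine min_eq_left ?_
  have := mul_nonneg (cast_lt_of_lt h).le (sub_nonneg.2 hab)
  linarith

theorem tpqOrder_of_ge (h : 2 * (p + q) < p * q) {a b : ℤ} (hab : a ≤ b) :
    tpqOrder p q a b = p * (q - 2) * a + 2 * p * b := by
  refine min_eq_right ?_
  have := mul_nonneg (cast_lt_of_lt h).le (sub_nonneg.2 hab)
  linarith

theorem tpqOrder_add_two (a b : ℤ) :
    tpqOrder p q (a + 2) (b + 2) = tpqOrder p q a b + 2 * p * q := by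
  rw [tpqOrder, tpqOrder, ← min_add_add_right]
  congr 1 <;> ring

theorem tpqOrder_add_left (h : 2 * (p + q) < p * q) {a b : ℤ} (hab : b ≤ a) :
    tpqOrder p q (a + p) b = tpqOrder p q a b + 2 * p * q := by
  rw [tpqOrder_of_le h hab, tpqOrder_of_le h (by omega)]
  ring

theorem tpqOrder_add_right (h : 2 * (p + q) < p * q) {a b : ℤ} (hab : a ≤ b) :
    tpqOrder p q a (b + q) = tpqOrder p q a b + 2 * p * q := by
  rw [tpqOrder_of_ge h hab, tpqOrder_of_ge h (by omega)]
  ring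

/-- The gain across the diagonal: the two forms exceed the left side by (pq - 2p - 2q)(b - a) and
(pq - 2p - 2q)p. -/
theorem lt_tpqOrder_add_left (h : 2 * (p + q) < p * q) {a b : ℤ} (hab : a < b) :
    tpqOrder p q a b + 2 * p * q < tpqOrder p q (a + p) b := by
  have h1 := cast_lt_of_lt h
  have hp : (0 : ℤ) < p := by have := three_le_left_of_lt h; omega
  rw [tpqOrder_of_ge h hab.le]
  refine lt_min ?_ ?_
  · have := mul_pos h1 (sub_pos.2 hab)
    linarith
  · have := mul_pos h1 hp
    linarith

theorem lt_tpqOrder_add_right (h : 2 * (p + q) < p * q) {a b : ℤ} (hab : b < a) :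
    tpqOrder p q a b + 2 * p * q < tpqOrder p q a (b + q) := by
  have h1 := cast_lt_of_lt h
  have hq : (0 : ℤ) < q := by have := three_le_right_of_lt h; omega
  rw [tpqOrder_of_le h hab.le]
  refine lt_min ?_ ?_
  · have := mul_pos h1 hq
    linarith
  · have := mul_pos h1 (sub_pos.2 hab)
    linarith

theorem add_le_tpqOrder (h : 2 * (p + q) < p * q) (a b : ℕ) :
    (a + b : ℤ) ≤ tpqOrder p q a b := by
  have hp : (3 : ℤ) ≤ p := by exact_mod_cast three_le_left_of_lt h
  have hq : (3 : ℤ) ≤ q := by exact_mod_cast three_le_right_of_lt h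
  have ha : (0 : ℤ) ≤ a := by positivity
  have hb : (0 : ℤ) ≤ b := by positivity
  refine le_min (add_le_add ?_ ?_) (add_le_add ?_ ?_) <;>
  · refine le_mul_of_one_le_left (by assumption) ?_
    nlinarith

end tpqOrder

/-! ### Everything above the polygon is tangent to leading order. -/

section surjectivity

variable {p q : ℕ} {c : K} {t : ℤ}

/-- If y divides the monomial, then so does x²y, and ∂/∂y of the normal form produces it. A pure
power of x comes from f₀ - (y/2)∂f₀/∂y. In both cases the remainder is a multiple of y^q in the cone
below the diagonal, hence of higher order. -/
theorem term_mem_leadingTangent_of_lt (h : 2 * (p + q) < p * q) (h2 : (2 : K) ≠ 0) (hc : c ≠ 0)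
    {a b : ℕ} (hab : b < a) (ht : 2 * p * q < t) (h_ab : tpqOrder p q a b = t) (r : K) :
    term a b r ∈ leadingTangent (tpqOrder p q) (2 * p * q) (tpq p q c) t := by
  have hq3 := three_le_right_of_lt h
  rcases b with _ | b
  · have hap : p < a := by
      rw [tpqOrder_of_le h (by omega)] at h_ab
      have : (0 : ℤ) < 2 * q * (a - p) := by push_cast at h_ab; linarith
      have := pos_of_mul_pos_right this (by positivity)
      omega
    obtain ⟨a, rfl⟩ := Nat.exists_eq_add_of_lt hap
    have e0 : tpqOrder p q (a + 1) 0 = t - 2 * p * q := by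
      have := tpqOrder_add_left h (show (0 : ℤ) ≤ a + 1 by omega)
      rw [← h_ab, eq_sub_iff_add_eq, ← this]
      congr 1
      push_cast
      ring
    have e1 : term (a + 1) 0 r ∈ orderFil K (tpqOrder p q) 0 0 (t - 2 * p * q) :=
      term_mem_orderFil _ _ _ (by simpa using e0.ge)
    -- The factor -1/2 cancels the x²y² terms.
    have e2 : term (a + 1) 1 (-r / 2) ∈ orderFil K (tpqOrder p q) 0 1 (t - 2 * p * q) :=
      term_mem_orderFil _ _ _ (by simpa using e0.ge)
    have e3 : term (a + 1) q (-r + r / 2 * q) ∈ orderFil K (tpqOrder p q) 0 0 (t + 1) := by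
      refine term_mem_orderFil _ _ _ ?_
      have := lt_tpqOrder_add_right h (show (0 : ℤ) < a + 1 by omega)
      rw [e0, sub_add_cancel] at this
      convert Int.add_one_le_of_lt this using 2 <;> push_cast <;> ring
    convert add_mem (add_mem (mul_mem_leadingTangent e1) (mul_pderiv_one_mem_leadingTangent e2))
      (orderFil_le_leadingTangent e3) using 1
    rw [pderiv_one_tpq, tpq_eq_term]
    simp only [mul_add, term_mul_term]
    have h1 : term (a + 1 + 2) (0 + 2) (r * c) + term (a + 1 + 2) (1 + 1) (-r / 2 * (2 * c)) = 0 := by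
      rw [zero_add, term_add_term, ← term_zero]
      congr 1
      field_simp
      ring
    have h3 : term (a + 1 + 0) (0 + q) (r * 1) + term (a + 1 + 0) (1 + (q - 1)) (-r / 2 * q)
        + term (a + 1) q (-r + r / 2 * q) = 0 := by
      rw [add_zero, zero_add, Nat.add_sub_cancel' (by omega), term_add_term, term_add_term,
        ← term_zero]
      congr 1
      ring
    have h4 : term (p + a + 1) 0 r = term (a + 1 + p) (0 + 0) (r * 1) := by
      congr 1 <;> ring
    linear_combination h4 - h1 - h3
  · obtain ⟨a, rfl⟩ : ∃ a', a = a' + 2 := ⟨a - 2, by omega⟩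
    have e0 : tpqOrder p q a (b - 1) = t - 2 * p * q := by
      rw [← h_ab, eq_sub_iff_add_eq, ← tpqOrder_add_two]
      congr 1
      push_cast
      ring
    -- For `b = 0` the field x^a ∂/∂y has exponent (a,-1); the order at negative exponents is really
    -- used.
    have e2 : term a b (r / (2 * c)) ∈ orderFil K (tpqOrder p q) 0 1 (t - 2 * p * q) :=
      term_mem_orderFil _ _ _ (by simpa using e0.ge)
    have e3 : term a (b + (q - 1)) (-r / (2 * c) * q) ∈ orderFil K (tpqOrder p q) 0 0 (t + 1) := by
      refine term_mem_orderFil _ _ _ ?_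
      have := lt_tpqOrder_add_right h (show (b - 1 : ℤ) < a by omega)
      rw [e0, sub_add_cancel] at this
      convert Int.add_one_le_of_lt this using 2
      · ring
      · push_cast [show 1 ≤ q by omega]
        ring
    convert add_mem (mul_pderiv_one_mem_leadingTangent e2)
      (orderFil_le_leadingTangent e3) using 1
    rw [pderiv_one_tpq]
    simp only [mul_add, term_mul_term]
    rw [add_zero, add_assoc, term_add_term, neg_div, neg_mul, add_neg_cancel, term_zero, add_zero]
    congr 1
    field_simp

/-- Mirror image across the diagonal, with ∂/∂x and x^p in place of ∂/∂y and y^q. -/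
theorem term_mem_leadingTangent_of_gt (h : 2 * (p + q) < p * q) (h2 : (2 : K) ≠ 0) (hc : c ≠ 0)
    {a b : ℕ} (hab : a < b) (ht : 2 * p * q < t) (h_ab : tpqOrder p q a b = t) (r : K) :
    term a b r ∈ leadingTangent (tpqOrder p q) (2 * p * q) (tpq p q c) t := by
  have hp3 := three_le_left_of_lt h
  rcases a with _ | a
  · have hap : q < b := by
      rw [tpqOrder_of_ge h (by omega)] at h_ab
      have : (0 : ℤ) < 2 * p * (b - q) := by push_cast at h_ab; linarith
      have := pos_of_mul_pos_right this (by positivity)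
      omega
    obtain ⟨b, rfl⟩ := Nat.exists_eq_add_of_lt hap
    have e0 : tpqOrder p q 0 (b + 1) = t - 2 * p * q := by
      have := tpqOrder_add_right h (show (0 : ℤ) ≤ b + 1 by omega)
      rw [← h_ab, eq_sub_iff_add_eq, ← this]
      congr 1
      push_cast
      ring
    have e1 : term 0 (b + 1) r ∈ orderFil K (tpqOrder p q) 0 0 (t - 2 * p * q) :=
      term_mem_orderFil _ _ _ (by simpa using e0.ge)
    have e2 : term 1 (b + 1) (-r / 2) ∈ orderFil K (tpqOrder p q) 1 0 (t - 2 * p * q) :=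
      term_mem_orderFil _ _ _ (by simpa using e0.ge)
    have e3 : term p (b + 1) (-r + r / 2 * p) ∈ orderFil K (tpqOrder p q) 0 0 (t + 1) := by
      refine term_mem_orderFil _ _ _ ?_
      have := lt_tpqOrder_add_left h (show (0 : ℤ) < b + 1 by omega)
      rw [e0, sub_add_cancel] at this
      convert Int.add_one_le_of_lt this using 2 <;> push_cast <;> ring
    convert add_mem (add_mem (mul_mem_leadingTangent e1) (mul_pderiv_zero_mem_leadingTangent e2))
      (orderFil_le_leadingTangent e3) using 1
    rw [pderiv_zero_tpq, tpq_eq_term]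
    simp only [mul_add, term_mul_term]
    have h1 : term (0 + 2) (b + 1 + 2) (r * c) + term (1 + 1) (b + 1 + 2) (-r / 2 * (2 * c)) = 0 := by
      rw [zero_add, term_add_term, ← term_zero]
      congr 1
      field_simp
      ring
    have h3 : term (0 + p) (b + 1 + 0) (r * 1) + term (1 + (p - 1)) (b + 1 + 0) (-r / 2 * p)
        + term p (b + 1) (-r + r / 2 * p) = 0 := by
      rw [add_zero, zero_add, Nat.add_sub_cancel' (by omega), term_add_term, term_add_term,
        ← term_zero]
      congr 1
      ring
    have h4 : term 0 (q + b + 1) r = term (0 + 0) (b + 1 + q) (r * 1) := by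
      congr 1 <;> ring
    linear_combination h4 - h1 - h3
  · obtain ⟨b, rfl⟩ : ∃ b', b = b' + 2 := ⟨b - 2, by omega⟩
    have e0 : tpqOrder p q (a - 1) b = t - 2 * p * q := by
      rw [← h_ab, eq_sub_iff_add_eq, ← tpqOrder_add_two]
      congr 1
      push_cast
      ring
    have e2 : term a b (r / (2 * c)) ∈ orderFil K (tpqOrder p q) 1 0 (t - 2 * p * q) :=
      term_mem_orderFil _ _ _ (by simpa using e0.ge)
    have e3 : term (a + (p - 1)) b (-r / (2 * c) * p) ∈ orderFil K (tpqOrder p q) 0 0 (t + 1) := by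
      refine term_mem_orderFil _ _ _ ?_
      have := lt_tpqOrder_add_left h (show (a - 1 : ℤ) < b by omega)
      rw [e0, sub_add_cancel] at this
      convert Int.add_one_le_of_lt this using 2
      · push_cast [show 1 ≤ p by omega]
        ring
      · ring
    convert add_mem (mul_pderiv_zero_mem_leadingTangent e2)
      (orderFil_le_leadingTangent e3) using 1
    rw [pderiv_zero_tpq]
    simp only [mul_add, term_mul_term]
    rw [add_zero, add_right_comm, term_add_term, neg_div, neg_mul, add_neg_cancel, term_zero,
      zero_add]
    congr 1
    field_simp

theorem term_mem_leadingTangent (h : 2 * (p + q) < p * q) (h2 : (2 : K) ≠ 0) (hc : c ≠ 0)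
    {a b : ℕ} (ht : 2 * p * q < t) (h_ab : tpqOrder p q a b = t) (r : K) :
    term a b r ∈ leadingTangent (tpqOrder p q) (2 * p * q) (tpq p q c) t := by
  have hp3 := three_le_left_of_lt h
  have hq3 := three_le_right_of_lt h
  rcases lt_trichotomy a b with hab | rfl | hab
  · exact term_mem_leadingTangent_of_gt h h2 hc hab ht h_ab r
  · have ha : 2 < a := by
      rw [tpqOrder_of_le h le_rfl] at h_ab
      have : (0 : ℤ) < p * q * (a - 2) := by linarith
      have := pos_of_mul_pos_right this (by positivity)
      omega
    obtain ⟨a, rfl⟩ := Nat.exists_eq_add_of_lt ha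
    have e0 : tpqOrder p q (a + 1) (a + 1) = t - 2 * p * q := by
      rw [← h_ab, eq_sub_iff_add_eq, ← tpqOrder_add_two]
      congr 1 <;> push_cast <;> ring
    have e2 : term (a + 1) (a + 2) (r / (2 * c)) ∈
        orderFil K (tpqOrder p q) 0 1 (t - 2 * p * q) :=
      term_mem_orderFil _ _ _ (by
        rw [show ((a + 2 : ℕ) - 1 : ℤ) = a + 1 by omega]
        simpa using e0.ge)
    -- On the diagonal multiplication by y^q gains nothing, so this remainder still has order `t`;
    -- but it lies strictly off the diagonal, where tangency is already known.
    have e3 : term (a + 1) (a + 2 + (q - 1)) (-r / (2 * c) * q) ∈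
        leadingTangent (tpqOrder p q) (2 * p * q) (tpq p q c) t := by
      refine term_mem_leadingTangent_of_gt h h2 hc (by omega) ht ?_ _
      have := tpqOrder_add_right h (le_refl (a + 1 : ℤ))
      rw [e0, sub_add_cancel] at this
      convert this using 2 <;> omega
    convert add_mem (mul_pderiv_one_mem_leadingTangent e2) e3 using 1
    rw [pderiv_one_tpq]
    simp only [mul_add, term_mul_term]
    rw [add_zero (a + 1), add_assoc (term _ _ _), term_add_term, neg_div, neg_mul, add_neg_cancel, term_zero, add_zero]
    congr 1
    · ring
    · ring
    · field_simp
  · exact term_mem_leadingTangent_of_lt h h2 hc hab ht h_ab r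

/-- Above the Newton polygon, every series is to leading order in the tangent space at `f`. -/
theorem orderFil_le_leadingTangent_of_sub_tpq_mem (h : 2 * (p + q) < p * q) (h2 : (2 : K) ≠ 0)
    (hc : c ≠ 0) (ht : 2 * p * q < t) {f : MvPowerSeries (Fin 2) K}
    (hf : f - tpq p q c ∈ orderFil K (tpqOrder p q) 0 0 (2 * p * q + 1)) :
    orderFil K (tpqOrder p q) 0 0 t ≤ leadingTangent (tpqOrder p q) (2 * p * q) f t :=
  (orderFil_le_of_term_mem (add_le_tpqOrder h) _ orderFil_le_leadingTangent
    fun _ _ hab => term_mem_leadingTangent h h2 hc ht hab 1).trans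
    (leadingTangent_le_of_sub_mem (isPlaneOrder_tpqOrder h) hf)

end surjectivity

end

/-! ### First order expansion and convergence to the normal form. -/

section

variable {K : Type*} [Field K] {l : ℤ → ℤ → ℤ}

/-- `a'` differs from `a` by `ξ a₀` up to higher order, where `a₀` is the leading part of `a`. -/
structure IsFirstOrder (l : ℤ → ℤ → ℤ)
    (ξ : Derivation K (MvPowerSeries (Fin 2) K) (MvPowerSeries (Fin 2) K)) (i j s : ℤ)
    (a₀ a a' : MvPowerSeries (Fin 2) K) : Prop where
  base_mem : a₀ ∈ orderFil K l i j 0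
  sub_base_mem : a - a₀ ∈ orderFil K l i j 1
  sub_mem : a' - a ∈ orderFil K l i j s
  sub_sub_mem : a' - a - ξ a₀ ∈ orderFil K l i j (s + 1)

namespace IsFirstOrder

variable {ξ : Derivation K (MvPowerSeries (Fin 2) K) (MvPowerSeries (Fin 2) K)}
  {i j i' j' s : ℤ} {a₀ a a' b₀ b b' : MvPowerSeries (Fin 2) K}

theorem mem (ha : IsFirstOrder l ξ i j s a₀ a a') : a ∈ orderFil K l i j 0 := by
  simpa using add_mem (orderFil_mono zero_le_one ha.sub_base_mem) ha.base_mem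

theorem mem' (hs : 1 ≤ s) (ha : IsFirstOrder l ξ i j s a₀ a a') : a' ∈ orderFil K l i j 0 := by
  simpa using add_mem (orderFil_mono (by linarith) ha.sub_mem) ha.mem

theorem mul (hl : IsPlaneOrder l) (hs : 1 ≤ s) (ha : IsFirstOrder l ξ i j s a₀ a a')
    (hb : IsFirstOrder l ξ i' j' s b₀ b b') :
    IsFirstOrder l ξ (i + i') (j + j') s (a₀ * b₀) (a * b) (a' * b') where
  base_mem := mul_mem_orderFil' hl ha.base_mem hb.base_mem
  sub_base_mem := mul_sub_mul_mem_orderFil hl ha.base_mem ha.sub_base_mem hb.mem hb.sub_base_mem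
  sub_mem := mul_sub_mul_mem_orderFil hl ha.mem ha.sub_mem (hb.mem' hs) hb.sub_mem
  sub_sub_mem := by
    -- Each summand has relative order at least s + 1; for the product of the two increments this is
    -- 2s ≥ s + 1.
    have e : a' * b' - a * b - ξ (a₀ * b₀) = (a' - a - ξ a₀) * b₀ + (a' - a) * (b - b₀)
        + (a' - a) * (b' - b) + (a - a₀) * (b' - b) + a₀ * (b' - b - ξ b₀) := by
      rw [Derivation.leibniz, smul_eq_mul, smul_eq_mul]
      ring
    rw [e]
    exact add_mem (add_mem (add_mem (add_mem
      (mul_mem_orderFil' hl ha.sub_sub_mem hb.base_mem)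
      (mul_mem_orderFil' hl ha.sub_mem hb.sub_base_mem))
      (mul_mem_orderFil' hl ha.sub_mem hb.sub_mem))
      (mul_mem_orderFil' hl ha.sub_base_mem hb.sub_mem))
      (mul_mem_orderFil' hl ha.base_mem hb.sub_sub_mem)

theorem one (hl : IsPlaneOrder l) : IsFirstOrder l ξ 0 0 s 1 1 1 where
  base_mem := mem_orderFil_zero hl 1
  sub_base_mem := by simp
  sub_mem := by simp
  sub_sub_mem := by simp

theorem pow (hl : IsPlaneOrder l) (hs : 1 ≤ s) (ha : IsFirstOrder l ξ i j s a₀ a a') (n : ℕ) :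
    IsFirstOrder l ξ (n * i) (n * j) s (a₀ ^ n) (a ^ n) (a' ^ n) := by
  induction n with
  | zero => simpa using one hl
  | succ n ih =>
    simp only [pow_succ]
    convert ih.mul hl hs ha using 1 <;> push_cast <;> ring

end IsFirstOrder

/-- The value of `x^p + c x^2 y^2 + y^q` at given power series. -/
def tpqEval (p q : ℕ) (c : K) (x y : MvPowerSeries (Fin 2) K) : MvPowerSeries (Fin 2) K :=
  x ^ p + c • (x ^ 2 * y ^ 2) + y ^ q

theorem tpqEval_X (p q : ℕ) (c : K) : tpqEval p q c (X 0) (X 1) = tpq p q c := by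
  rw [tpqEval, tpq, smul_eq_C_mul, mul_assoc]

theorem map_tpq (p q : ℕ) (c : K)
    (φ : MvPowerSeries (Fin 2) K ≃ₐ[K] MvPowerSeries (Fin 2) K) :
    φ (tpq p q c) = tpqEval p q c (φ (X 0)) (φ (X 1)) := by
  rw [← tpqEval_X, tpqEval, tpqEval]
  simp only [map_add, map_pow, map_smul, map_mul]

section tpq

variable {p q : ℕ} {c : K}

theorem tpqOrder_left (h : 2 * (p + q) < p * q) : tpqOrder p q p 0 = 2 * p * q := by
  rw [tpqOrder_of_le h (by positivity)]
  ring

theorem tpqOrder_right (h : 2 * (p + q) < p * q) : tpqOrder p q 0 q = 2 * p * q := by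
  rw [tpqOrder_of_ge h (by positivity)]
  ring

theorem tpqOrder_two_two (h : 2 * (p + q) < p * q) : tpqOrder p q 2 2 = 2 * p * q := by
  rw [tpqOrder_of_ge h le_rfl]
  ring

theorem tpq_mem_orderFil (h : 2 * (p + q) < p * q) :
    tpq p q c ∈ orderFil K (tpqOrder p q) 0 0 (2 * p * q) := by
  rw [tpq_eq_term]
  refine add_mem (add_mem ?_ ?_) ?_ <;> refine term_mem_orderFil _ _ _ ?_
  · simpa using (tpqOrder_left h).ge
  · simpa using (tpqOrder_two_two h).ge
  · simpa using (tpqOrder_right h).ge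

theorem tpqEval_sub_tpqEval_mem (h : 2 * (p + q) < p * q) {s : ℤ} (hs : 0 ≤ s)
    {x x' y y' : MvPowerSeries (Fin 2) K} (hx : x ∈ orderFil K (tpqOrder p q) 1 0 0)
    (hxx : x' - x ∈ orderFil K (tpqOrder p q) 1 0 s) (hy : y ∈ orderFil K (tpqOrder p q) 0 1 0)
    (hyy : y' - y ∈ orderFil K (tpqOrder p q) 0 1 s) :
    tpqEval p q c x' y' - tpqEval p q c x y ∈
      orderFil K (tpqOrder p q) 0 0 (2 * p * q + s) := by
  have hl := isPlaneOrder_tpqOrder h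
  have key := pow_mul_pow_sub_mem_orderFil hl hs hx hxx hy hyy
  have e : tpqEval p q c x' y' - tpqEval p q c x y = (x' ^ p * y' ^ 0 - x ^ p * y ^ 0)
      + c • (x' ^ 2 * y' ^ 2 - x ^ 2 * y ^ 2) + (x' ^ 0 * y' ^ q - x ^ 0 * y ^ q) := by
    rw [tpqEval, tpqEval, smul_sub]
    ring
  rw [e]
  refine add_mem (add_mem ?_ (Submodule.smul_mem _ _ ?_)) ?_
  · refine orderFil_shift hl ?_ (key p 0)
    simpa [add_comm] using (tpqOrder_left h).ge
  · refine orderFil_shift hl ?_ (key 2 2)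
    simpa [add_comm] using (tpqOrder_two_two h).ge
  · refine orderFil_shift hl ?_ (key 0 q)
    simpa [add_comm] using (tpqOrder_right h).ge

theorem tpqEval_mem (h : 2 * (p + q) < p * q)
    {x y : MvPowerSeries (Fin 2) K} (hx : x - X 0 ∈ orderFil K (tpqOrder p q) 1 0 1)
    (hy : y - X 1 ∈ orderFil K (tpqOrder p q) 0 1 1) :
    tpqEval p q c x y ∈ orderFil K (tpqOrder p q) 0 0 (2 * p * q) := by
  have hl := isPlaneOrder_tpqOrder h
  have := tpqEval_sub_tpqEval_mem (c := c) h zero_le_one (X_zero_mem_orderFil hl) hx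
    (X_one_mem_orderFil hl) hy
  rw [tpqEval_X] at this
  simpa using add_mem (orderFil_mono (by linarith) this) (tpq_mem_orderFil (c := c) h)

/-- First order expansion of `u * tpq (x, y)` in `u`, `x` and `y`. -/
theorem mul_tpqEval_first_order (h : 2 * (p + q) < p * q) {s : ℤ} (hs : 1 ≤ s)
    {u x y g a b : MvPowerSeries (Fin 2) K} (hu : u - 1 ∈ orderFil K (tpqOrder p q) 0 0 1)
    (hx : x - X 0 ∈ orderFil K (tpqOrder p q) 1 0 1)
    (hy : y - X 1 ∈ orderFil K (tpqOrder p q) 0 1 1)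
    (hg : g ∈ orderFil K (tpqOrder p q) 0 0 s) (ha : a ∈ orderFil K (tpqOrder p q) 1 0 s)
    (hb : b ∈ orderFil K (tpqOrder p q) 0 1 s) :
    (u + g) * tpqEval p q c (x + a) (y + b) - u * tpqEval p q c x y
      - (g * tpq p q c + a * pderiv K 0 (tpq p q c) + b * pderiv K 1 (tpq p q c)) ∈
      orderFil K (tpqOrder p q) 0 0 (2 * p * q + s + 1) := by
  have hl := isPlaneOrder_tpqOrder h
  set ξ : Derivation K (MvPowerSeries (Fin 2) K) (MvPowerSeries (Fin 2) K) :=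
    a • pderiv K 0 + b • pderiv K 1 with hξ
  have ξ_apply : ∀ f, ξ f = a * pderiv K 0 f + b * pderiv K 1 f := fun _ => rfl
  have fx : IsFirstOrder (tpqOrder p q) ξ 1 0 s (X 0) x (x + a) :=
    ⟨X_zero_mem_orderFil hl, hx, by simpa using ha, by
      rw [ξ_apply, pderiv_X_self, pderiv_X_of_ne (by decide)]; simp⟩
  have fy : IsFirstOrder (tpqOrder p q) ξ 0 1 s (X 1) y (y + b) :=
    ⟨X_one_mem_orderFil hl, hy, by simpa using hb, by
      rw [ξ_apply, pderiv_X_self, pderiv_X_of_ne (by decide)]; simp⟩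
  have fm : ∀ m n : ℕ, IsFirstOrder (tpqOrder p q) ξ m n s (X 0 ^ m * X 1 ^ n) (x ^ m * y ^ n)
      ((x + a) ^ m * (y + b) ^ n) := by
    intro m n
    have := (fx.pow hl hs m).mul hl hs (fy.pow hl hs n)
    simpa using this
  have gm : ∀ m n : ℕ, tpqOrder p q m n = 2 * p * q →
      (x + a) ^ m * (y + b) ^ n - x ^ m * y ^ n - ξ (X 0 ^ m * X 1 ^ n) ∈
        orderFil K (tpqOrder p q) 0 0 (2 * p * q + s + 1) := by
    intro m n hmn
    refine orderFil_shift hl ?_ (fm m n).sub_sub_mem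
    rw [sub_zero, sub_zero, hmn]
    linarith
  have e0 : tpqEval p q c (x + a) (y + b) - tpqEval p q c x y - ξ (tpq p q c) ∈
      orderFil K (tpqOrder p q) 0 0 (2 * p * q + s + 1) := by
    have e : tpqEval p q c (x + a) (y + b) - tpqEval p q c x y - ξ (tpq p q c) =
        ((x + a) ^ p * (y + b) ^ 0 - x ^ p * y ^ 0 - ξ (X 0 ^ p * X 1 ^ 0))
        + c • ((x + a) ^ 2 * (y + b) ^ 2 - x ^ 2 * y ^ 2 - ξ (X 0 ^ 2 * X 1 ^ 2))
        + ((x + a) ^ 0 * (y + b) ^ q - x ^ 0 * y ^ q - ξ (X 0 ^ 0 * X 1 ^ q)) := by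
      rw [← tpqEval_X, tpqEval, tpqEval, tpqEval, map_add, map_add, Derivation.map_smul, smul_sub, smul_sub]
      simp only [pow_zero, mul_one, one_mul]
      ring
    rw [e]
    exact add_mem (add_mem (gm p 0 (by simpa using tpqOrder_left h))
      (Submodule.smul_mem _ _ (gm 2 2 (by simpa using tpqOrder_two_two h))))
      (gm 0 q (by simpa using tpqOrder_right h))
  have e1 : tpqEval p q c (x + a) (y + b) - tpqEval p q c x y ∈
      orderFil K (tpqOrder p q) 0 0 (2 * p * q + s) :=
    tpqEval_sub_tpqEval_mem h (by linarith) fx.mem (by simpa using ha) fy.mem (by simpa using hb)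
  have e2 : tpqEval p q c x y - tpq p q c ∈ orderFil K (tpqOrder p q) 0 0 (2 * p * q + 1) := by
    rw [← tpqEval_X]
    exact tpqEval_sub_tpqEval_mem h (by linarith) (X_zero_mem_orderFil hl) hx
      (X_one_mem_orderFil hl) hy
  have e : (u + g) * tpqEval p q c (x + a) (y + b) - u * tpqEval p q c x y
      - (g * tpq p q c + a * pderiv K 0 (tpq p q c) + b * pderiv K 1 (tpq p q c)) =
      (tpqEval p q c (x + a) (y + b) - tpqEval p q c x y - ξ (tpq p q c))
      + (u - 1) * (tpqEval p q c (x + a) (y + b) - tpqEval p q c x y)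
      + g * (tpqEval p q c (x + a) (y + b) - tpqEval p q c x y)
      + g * (tpqEval p q c x y - tpq p q c) := by
    rw [ξ_apply]
    ring
  rw [e]
  exact add_mem (add_mem (add_mem e0 (mul_mem_orderFil' hl hu e1)) (mul_mem_orderFil' hl hg e1))
    (mul_mem_orderFil' hl hg e2)

/-- `u * tpq (x, y)` approximates `f` to order `k` above the Newton polygon. -/
structure IsTpqApprox (p q : ℕ) (c : K) (f : MvPowerSeries (Fin 2) K) (k : ℕ)
    (z : MvPowerSeries (Fin 2) K × MvPowerSeries (Fin 2) K × MvPowerSeries (Fin 2) K) : Prop where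
  unit_sub_mem : z.1 - 1 ∈ orderFil K (tpqOrder p q) 0 0 1
  left_sub_mem : z.2.1 - X 0 ∈ orderFil K (tpqOrder p q) 1 0 1
  right_sub_mem : z.2.2 - X 1 ∈ orderFil K (tpqOrder p q) 0 1 1
  approx_mem : f - z.1 * tpqEval p q c z.2.1 z.2.2 ∈
    orderFil K (tpqOrder p q) 0 0 (2 * p * q + (k + 1 : ℕ))

/-- One correction step. Its increments have order k + 1, but k is recorded because that is the form
`exists_limit_orderFil` takes. -/
theorem IsTpqApprox.exists_step (h : 2 * (p + q) < p * q) (h2 : (2 : K) ≠ 0) (hc : c ≠ 0)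
    {f : MvPowerSeries (Fin 2) K} {k : ℕ}
    {z : MvPowerSeries (Fin 2) K × MvPowerSeries (Fin 2) K × MvPowerSeries (Fin 2) K}
    (hz : IsTpqApprox p q c f k z) :
    ∃ z', IsTpqApprox p q c f (k + 1) z' ∧
      z'.1 - z.1 ∈ orderFil K (tpqOrder p q) 0 0 k ∧
      z'.2.1 - z.2.1 ∈ orderFil K (tpqOrder p q) 1 0 k ∧
      z'.2.2 - z.2.2 ∈ orderFil K (tpqOrder p q) 0 1 k := by
  obtain ⟨u, x, y⟩ := z
  obtain ⟨hu, hx, hy, hf⟩ := hz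
  dsimp only at hu hx hy hf
  -- The error is always resolved in the tangent space at the fixed normal form; passing to the
  -- current approximation costs only higher order.
  obtain ⟨g, hg, a, ha, b, hb, e⟩ := orderFil_le_leadingTangent_of_sub_tpq_mem h h2 hc
    (t := 2 * p * q + (k + 1 : ℕ)) (by push_cast; linarith) (f := tpq p q c) (by simp) hf
  rw [add_sub_cancel_left] at hg ha hb
  have hk : (1 : ℤ) ≤ (k + 1 : ℕ) := by push_cast; linarith
  have hk' : (k : ℤ) ≤ (k + 1 : ℕ) := by push_cast; linarith
  refine ⟨(u + g, x + a, y + b), ⟨?_, ?_, ?_, ?_⟩, ?_, ?_, ?_⟩ <;> dsimp only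
  · rw [add_sub_right_comm]
    exact add_mem hu (orderFil_mono hk hg)
  · rw [add_sub_right_comm]
    exact add_mem hx (orderFil_mono hk ha)
  · rw [add_sub_right_comm]
    exact add_mem hy (orderFil_mono hk hb)
  · have e' := mul_tpqEval_first_order (c := c) h hk hu hx hy hg ha hb
    rw [Nat.cast_succ (k + 1), ← add_assoc]
    convert sub_mem e e' using 1
    ring
  · simpa using orderFil_mono hk' hg
  · simpa using orderFil_mono hk' ha
  · simpa using orderFil_mono hk' hb

theorem exists_eq_mul_tpqEval (h : 2 * (p + q) < p * q) (h2 : (2 : K) ≠ 0) (hc : c ≠ 0)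
    {f : MvPowerSeries (Fin 2) K}
    (hf : f - tpq p q c ∈ orderFil K (tpqOrder p q) 0 0 (2 * p * q + 1)) :
    ∃ u x y : MvPowerSeries (Fin 2) K, u - 1 ∈ orderFil K (tpqOrder p q) 0 0 1 ∧
      x - X 0 ∈ orderFil K (tpqOrder p q) 1 0 1 ∧ y - X 1 ∈ orderFil K (tpqOrder p q) 0 1 1 ∧
      f = u * tpqEval p q c x y := by
  have hl := isPlaneOrder_tpqOrder h
  choose! step hstep using fun (k : ℕ)
    (z : MvPowerSeries (Fin 2) K × MvPowerSeries (Fin 2) K × MvPowerSeries (Fin 2) K)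
    (hz : IsTpqApprox p q c f k z) => hz.exists_step h h2 hc
  let z : ℕ → MvPowerSeries (Fin 2) K × MvPowerSeries (Fin 2) K × MvPowerSeries (Fin 2) K :=
    fun k => Nat.rec (1, X 0, X 1) step k
  have hz : ∀ k, IsTpqApprox p q c f k (z k) := by
    intro k
    induction k with
    | zero => exact ⟨by simp [z], by simp [z], by simp [z], by simpa [z, tpqEval_X] using hf⟩
    | succ k ih => exact (hstep k _ ih).1
  obtain ⟨u, hu⟩ := exists_limit_orderFil (a := fun k => (z k).1)
    fun k => (hstep k _ (hz k)).2.1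
  obtain ⟨x, hx⟩ := exists_limit_orderFil (a := fun k => (z k).2.1)
    fun k => (hstep k _ (hz k)).2.2.1
  obtain ⟨y, hy⟩ := exists_limit_orderFil (a := fun k => (z k).2.2)
    fun k => (hstep k _ (hz k)).2.2.2
  have hu1 : u - 1 ∈ orderFil K (tpqOrder p q) 0 0 1 := by
    simpa using add_mem (hu 1) (hz 1).unit_sub_mem
  have hx1 : x - X 0 ∈ orderFil K (tpqOrder p q) 1 0 1 := by
    simpa using add_mem (hx 1) (hz 1).left_sub_mem
  have hy1 : y - X 1 ∈ orderFil K (tpqOrder p q) 0 1 1 := by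
    simpa using add_mem (hy 1) (hz 1).right_sub_mem
  refine ⟨u, x, y, hu1, hx1, hy1, sub_eq_zero.1 ?_⟩
  refine eq_zero_of_forall_mem_orderFil (l := tpqOrder p q) (i := 0) (j := 0) fun k => ?_
  have hD : (0 : ℤ) ≤ 2 * p * q := by positivity
  have hzx : (z k).2.1 ∈ orderFil K (tpqOrder p q) 1 0 0 := by
    simpa using add_mem (orderFil_mono zero_le_one (hz k).left_sub_mem) (X_zero_mem_orderFil hl)
  have hzy : (z k).2.2 ∈ orderFil K (tpqOrder p q) 0 1 0 := by
    simpa using add_mem (orderFil_mono zero_le_one (hz k).right_sub_mem) (X_one_mem_orderFil hl)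
  have e1 := tpqEval_sub_tpqEval_mem (c := c) h (Int.natCast_nonneg k) hzx (hx k) hzy (hy k)
  have e2 := tpqEval_mem (c := c) h hx1 hy1
  have e : f - u * tpqEval p q c x y = (f - (z k).1 * tpqEval p q c (z k).2.1 (z k).2.2)
      - (z k).1 * (tpqEval p q c x y - tpqEval p q c (z k).2.1 (z k).2.2)
      - (u - (z k).1) * tpqEval p q c x y := by ring
  rw [e]
  refine sub_mem (sub_mem (orderFil_mono ?_ (hz k).approx_mem)
    (mul_mem_orderFil' hl (mem_orderFil_zero hl _) e1)) (mul_mem_orderFil' hl (hu k) e2)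
  push_cast
  linarith

theorem contactEquiv_tpq (h : 2 * (p + q) < p * q) (h2 : (2 : K) ≠ 0) (hc : c ≠ 0)
    {f : MvPowerSeries (Fin 2) K}
    (hf : f - tpq p q c ∈ orderFil K (tpqOrder p q) 0 0 (2 * p * q + 1)) :
    ContactEquiv f (tpq p q c) := by
  have hl := isPlaneOrder_tpqOrder h
  obtain ⟨u, x, y, hu, hx, hy, e⟩ := exists_eq_mul_tpqEval h h2 hc hf
  obtain ⟨φ, hφx, hφy⟩ := exists_algEquiv_of_sub_mem_orderFil hl hx hy
  have hunit : IsUnit u := by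
    rw [isUnit_iff_constantCoeff]
    have h0 : coeff 0 (u - 1) = 0 := coeff_eq_zero_of_mem_orderFil hu (by simp [tpqOrder])
    rw [map_sub, coeff_zero_one, sub_eq_zero, coeff_zero_eq_constantCoeff_apply] at h0
    rw [h0]
    exact isUnit_one
  refine ⟨φ, hunit.unit, ?_⟩
  rw [map_tpq, hφx, hφy, IsUnit.unit_spec]
  exact e

end tpq

end

/-! ### Absence of cancellation up to the polygon. -/

section

variable {K : Type*} [Field K] {p q : ℕ} {c : K}

section lowOrder

/-- A monomial of `a` of negative order s must be y^j. It contributes 2c x y^(j+2), and no other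
term of the combination can cancel this coefficient. -/
theorem mem_orderFil_succ_left (h : 2 * (p + q) < p * q) (h2 : (2 : K) ≠ 0) (hc : c ≠ 0) {s : ℤ}
    (hs : s < 0) {a b : MvPowerSeries (Fin 2) K} (ha : a ∈ orderFil K (tpqOrder p q) 1 0 s)
    (hb : b ∈ orderFil K (tpqOrder p q) 0 1 s)
    (hab : a * pderiv K 0 (tpq p q c) + b * pderiv K 1 (tpq p q c) ∈
      orderFil K (tpqOrder p q) 0 0 (s + 2 * p * q + 1)) :
    a ∈ orderFil K (tpqOrder p q) 1 0 (s + 1) := by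
  have hp3 := three_le_left_of_lt h
  intro α hα
  by_contra hlt
  have hle := ha α hα
  have heq : tpqOrder p q (α 0 - 1) (α 1 - 0) = s := by omega
  have hα0 : α 0 = 0 := by
    by_contra h0
    have := (isPlaneOrder_tpqOrder h).nonneg (α 0 - 1) (α 1 - 0) (by omega) (by omega)
    omega
  obtain ⟨j, hj⟩ : ∃ j, j = α 1 := ⟨_, rfl⟩
  have hαj : α = Finsupp.single 0 0 + Finsupp.single 1 j := by
    rw [hj, ← hα0, single_add_single_eq]
  rw [hα0, ← hj, sub_zero, Nat.cast_zero, zero_sub] at heq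
  have h0 : coeff (Finsupp.single 0 1 + Finsupp.single 1 (j + 2))
      (a * pderiv K 0 (tpq p q c) + b * pderiv K 1 (tpq p q c)) = 0 := by
    refine coeff_eq_zero_of_mem_orderFil hab ?_
    rw [single_add_single_apply_zero, single_add_single_apply_one]
    have := tpqOrder_add_two (p := p) (q := q) (-1) j
    rw [heq] at this
    rw [show ((1 : ℕ) : ℤ) - 0 = -1 + 2 by norm_num,
      show ((j + 2 : ℕ) : ℤ) - 0 = j + 2 by push_cast; ring, this]
    linarith
  -- The only possible competitor is q y^(q-1) times a monomial of `b`. Negative order gives 2j < q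
  -- - 2, which forces q = 3, j = 0 and the monomial x. Its order in `b` is at most 12 - 3p, which
  -- is less than s = -p because p > 6.
  have hb0 : q - 1 ≤ j + 2 →
      coeff (Finsupp.single 0 1 + Finsupp.single 1 (j + 2 - (q - 1))) b = 0 := by
    intro hqj
    refine coeff_eq_zero_of_mem_orderFil hb ?_
    rw [single_add_single_apply_zero, single_add_single_apply_one]
    rw [tpqOrder_of_ge h (by omega)] at heq
    have hneg : (p : ℤ) * (2 * j - (q - 2)) < 0 := by linarith
    have hneg' := neg_of_mul_neg_right hneg (by positivity)
    have hq3 := three_le_right_of_lt h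
    have hq : q = 3 := by omega
    have hj0 : j = 0 := by omega
    subst hq hj0
    refine lt_of_le_of_lt (min_le_left _ _) ?_
    push_cast at heq ⊢
    omega
  rw [pderiv_zero_tpq, pderiv_one_tpq, mul_add, mul_add, map_add, map_add, map_add,
    coeff_mul_term, coeff_mul_term, coeff_mul_term, coeff_mul_term, single_add_single_apply_zero,
    single_add_single_apply_one, if_neg (by omega), if_pos (by omega), if_neg (by omega),
    Nat.sub_self, Nat.add_sub_cancel, ← hαj] at h0
  rw [hαj] at hα
  split_ifs at h0 with hqj
  · rw [Nat.sub_zero, hb0 hqj.2] at h0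
    simp only [zero_mul, add_zero, zero_add] at h0
    rw [hαj] at h0
    exact mul_ne_zero hα (mul_ne_zero h2 hc) h0
  · simp only [add_zero, zero_add] at h0
    rw [hαj] at h0
    exact mul_ne_zero hα (mul_ne_zero h2 hc) h0

/-- Mirror image: the critical monomials of `b` are x^i, contributing 2c x^(i+2) y. -/
theorem mem_orderFil_succ_right (h : 2 * (p + q) < p * q) (h2 : (2 : K) ≠ 0) (hc : c ≠ 0) {s : ℤ}
    (hs : s < 0) {a b : MvPowerSeries (Fin 2) K} (ha : a ∈ orderFil K (tpqOrder p q) 1 0 s)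
    (hb : b ∈ orderFil K (tpqOrder p q) 0 1 s)
    (hab : a * pderiv K 0 (tpq p q c) + b * pderiv K 1 (tpq p q c) ∈
      orderFil K (tpqOrder p q) 0 0 (s + 2 * p * q + 1)) :
    b ∈ orderFil K (tpqOrder p q) 0 1 (s + 1) := by
  have hq3 := three_le_right_of_lt h
  intro α hα
  by_contra hlt
  have hle := hb α hα
  have heq : tpqOrder p q (α 0 - 0) (α 1 - 1) = s := by omega
  have hα1 : α 1 = 0 := by
    by_contra h0
    have := (isPlaneOrder_tpqOrder h).nonneg (α 0 - 0) (α 1 - 1) (by omega) (by omega)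
    omega
  obtain ⟨i, hi⟩ : ∃ i, i = α 0 := ⟨_, rfl⟩
  have hαi : α = Finsupp.single 0 i + Finsupp.single 1 0 := by
    rw [hi, ← hα1, single_add_single_eq]
  rw [hα1, ← hi, sub_zero, Nat.cast_zero, zero_sub] at heq
  have h0 : coeff (Finsupp.single 0 (i + 2) + Finsupp.single 1 1)
      (a * pderiv K 0 (tpq p q c) + b * pderiv K 1 (tpq p q c)) = 0 := by
    refine coeff_eq_zero_of_mem_orderFil hab ?_
    rw [single_add_single_apply_zero, single_add_single_apply_one]
    have := tpqOrder_add_two (p := p) (q := q) i (-1)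
    rw [heq] at this
    rw [show ((1 : ℕ) : ℤ) - 0 = -1 + 2 by norm_num,
      show ((i + 2 : ℕ) : ℤ) - 0 = i + 2 by push_cast; ring, this]
    linarith
  have ha0 : p - 1 ≤ i + 2 →
      coeff (Finsupp.single 0 (i + 2 - (p - 1)) + Finsupp.single 1 1) a = 0 := by
    intro hpi
    refine coeff_eq_zero_of_mem_orderFil ha ?_
    rw [single_add_single_apply_zero, single_add_single_apply_one]
    rw [tpqOrder_of_le h (by omega)] at heq
    have hneg : (q : ℤ) * (2 * i - (p - 2)) < 0 := by linarith
    have hneg' := neg_of_mul_neg_right hneg (by positivity)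
    have hp3 := three_le_left_of_lt h
    have hp : p = 3 := by omega
    have hi0 : i = 0 := by omega
    subst hp hi0
    refine lt_of_le_of_lt (min_le_right _ _) ?_
    push_cast at heq ⊢
    omega
  rw [pderiv_zero_tpq, pderiv_one_tpq, mul_add, mul_add, map_add, map_add, map_add,
    coeff_mul_term, coeff_mul_term, coeff_mul_term, coeff_mul_term, single_add_single_apply_zero,
    single_add_single_apply_one, if_neg (c := _ ∧ 2 ≤ 1) (by omega),
    if_pos (c := 2 ≤ i + 2 ∧ 1 ≤ 1) (by omega),
    if_neg (c := _ ∧ q - 1 ≤ 1) (by omega), Nat.sub_self, Nat.add_sub_cancel, ← hαi] at h0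
  rw [hαi] at hα
  split_ifs at h0 with hpi
  · rw [Nat.sub_zero, ha0 hpi.1] at h0
    simp only [zero_mul, add_zero, zero_add] at h0
    rw [hαi] at h0
    exact mul_ne_zero hα (mul_ne_zero h2 hc) h0
  · simp only [add_zero, zero_add] at h0
    rw [hαi] at h0
    exact mul_ne_zero hα (mul_ne_zero h2 hc) h0

/-- On and below the Newton polygon there is no cancellation in the tangent space at `f`. -/
theorem coefficients_mem_orderFil_of_le (h : 2 * (p + q) < p * q) (h2 : (2 : K) ≠ 0) (hc : c ≠ 0)
    {f g a b : MvPowerSeries (Fin 2) K} {t : ℤ} (ht : t ≤ 2 * p * q)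
    (hf : f - tpq p q c ∈ orderFil K (tpqOrder p q) 0 0 (2 * p * q + 1))
    (hmem : g * f + a * pderiv K 0 f + b * pderiv K 1 f ∈ orderFil K (tpqOrder p q) 0 0 t) :
    a ∈ orderFil K (tpqOrder p q) 1 0 (t - 2 * p * q) ∧
      b ∈ orderFil K (tpqOrder p q) 0 1 (t - 2 * p * q) := by
  have hl := isPlaneOrder_tpqOrder h
  have hfD : f ∈ orderFil K (tpqOrder p q) 0 0 (2 * p * q) := by
    simpa using add_mem (orderFil_mono (by linarith) hf) (tpq_mem_orderFil (c := c) h)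
  -- Every derivation has order at least that of ∂/∂x or ∂/∂y, which starts the induction.
  obtain ⟨s₀, hs₀⟩ : ∃ s₀, s₀ = min (t - 2 * p * q)
    (min (tpqOrder p q (-1) 0) (tpqOrder p q 0 (-1))) := ⟨_, rfl⟩
  have base : a ∈ orderFil K (tpqOrder p q) 1 0 s₀ ∧ b ∈ orderFil K (tpqOrder p q) 0 1 s₀ := by
    constructor
    · refine orderFil_shift hl ?_ (mem_orderFil_zero hl a)
      rw [zero_add, zero_sub, sub_zero, hs₀]
      exact (min_le_right _ _).trans (min_le_left _ _)
    · refine orderFil_shift hl ?_ (mem_orderFil_zero hl b)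
      rw [zero_add, sub_zero, zero_sub, hs₀]
      exact (min_le_right _ _).trans (min_le_right _ _)
  have key : ∀ s, s₀ ≤ s → s ≤ t - 2 * p * q → a ∈ orderFil K (tpqOrder p q) 1 0 s ∧
      b ∈ orderFil K (tpqOrder p q) 0 1 s := by
    intro s hs
    induction s, hs using Int.leInduction with
    | base => exact fun _ => base
    | succ s hs ih =>
      intro hst
      obtain ⟨ha, hb⟩ := ih (by linarith)
      have hab : a * pderiv K 0 (tpq p q c) + b * pderiv K 1 (tpq p q c) ∈
          orderFil K (tpqOrder p q) 0 0 (s + 2 * p * q + 1) := by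
        -- As s + 1 ≤ 0, the product `g * f` of order at least 2pq cannot interfere.
        have e : a * pderiv K 0 (tpq p q c) + b * pderiv K 1 (tpq p q c) =
            (g * f + a * pderiv K 0 f + b * pderiv K 1 f) - g * f
            - a * pderiv K 0 (f - tpq p q c) - b * pderiv K 1 (f - tpq p q c) := by
          rw [map_sub, map_sub]
          ring
        rw [e]
        exact sub_mem (sub_mem (sub_mem (orderFil_mono (by linarith) hmem)
          (mul_mem_orderFil' hl (mem_orderFil_zero hl g) hfD))
          (mul_mem_orderFil' hl ha (pderiv_zero_mem_orderFil hf)))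
          (mul_mem_orderFil' hl hb (pderiv_one_mem_orderFil hf))
      exact ⟨mem_orderFil_succ_left h h2 hc (by linarith) ha hb hab,
        mem_orderFil_succ_right h h2 hc (by linarith) ha hb hab⟩
  exact key _ (hs₀ ▸ min_le_left _ _) le_rfl

theorem exists_eq_of_mem_tjurinaIdeal {f h : MvPowerSeries (Fin 2) K} (hh : h ∈ tjurinaIdeal f) :
    ∃ g a b, h = g * f + a * pderiv K 0 f + b * pderiv K 1 f := by
  rw [tjurinaIdeal, Set.singleton_union, Ideal.mem_span_insert] at hh
  obtain ⟨g, z, hz, rfl⟩ := hh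
  rw [Ideal.mem_span_range_iff_exists_fun] at hz
  obtain ⟨a, rfl⟩ := hz
  exact ⟨g, a 0, a 1, by rw [Fin.sum_univ_two]; ring⟩

theorem mem_leadingTangent_of_mem_tjurinaIdeal (h : 2 * (p + q) < p * q) (h2 : (2 : K) ≠ 0)
    (hc : c ≠ 0) {f w : MvPowerSeries (Fin 2) K}
    (hf : f - tpq p q c ∈ orderFil K (tpqOrder p q) 0 0 (2 * p * q + 1))
    (hw : w ∈ tjurinaIdeal f) {t : ℤ} (hwt : w ∈ orderFil K (tpqOrder p q) 0 0 t) :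
    w ∈ leadingTangent (tpqOrder p q) (2 * p * q) f t := by
  rcases lt_or_ge (2 * p * q : ℤ) t with ht | ht
  · exact orderFil_le_leadingTangent_of_sub_tpq_mem h h2 hc ht hf hwt
  · obtain ⟨g, a, b, rfl⟩ := exists_eq_of_mem_tjurinaIdeal hw
    obtain ⟨ha, hb⟩ := coefficients_mem_orderFil_of_le h h2 hc ht hf hwt
    exact ⟨g, orderFil_mono (by linarith) (mem_orderFil_zero (isPlaneOrder_tpqOrder h) g), a, ha,
      b, hb, by simp⟩

end lowOrder

/-! ### From the integral order to the valuations and condition AC. -/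

section valuation

namespace CPolytope

variable {P : CPolytope 2} {l : ℤ → ℤ → ℤ} {κ : ℝ}

/-- The integral function `l` is proportional, with factor `κ`, to the piecewise valuation
of `P` on the exponent lattice. -/
structure IsScaledOrder (P : CPolytope 2) (l : ℤ → ℤ → ℤ) (κ : ℝ) : Prop where
  pos : 0 < κ
  denom_mul_lam : ∀ (a b : ℤ) (r : Fin 2 → ℝ), r 0 = a → r 1 = b →
    (P.denom : ℝ) * P.lam r = κ * l a b

theorem val_le_of_coeff_ne_zero (hP : P.IsScaledOrder l κ) {h : MvPowerSeries (Fin 2) K}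
    {α : Fin 2 →₀ ℕ} (hα : coeff α h ≠ 0) :
    P.val h ≤ ((κ * l (α 0) (α 1) : ℝ) : EReal) := by
  refine (iInf₂_le α hα).trans (le_of_eq ?_)
  rw [hP.denom_mul_lam (α 0) (α 1) _ (by simp) (by simp)]

theorem le_val_of_mem (hP : P.IsScaledOrder l κ) {h : MvPowerSeries (Fin 2) K} {t : ℤ}
    (hh : h ∈ orderFil K l 0 0 t) : ((κ * t : ℝ) : EReal) ≤ P.val h := by
  refine le_iInf₂ fun α hα => ?_
  rw [hP.denom_mul_lam (α 0) (α 1) _ (by simp) (by simp), EReal.coe_le_coe_iff]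
  have := hh α hα
  rw [sub_zero, sub_zero] at this
  exact mul_le_mul_of_nonneg_left (by exact_mod_cast this) hP.pos.le

/-- Since `l` is integral, a strict inequality of valuations gains a full unit of order. -/
theorem mem_of_lt_val (hP : P.IsScaledOrder l κ) {h : MvPowerSeries (Fin 2) K} {t : ℤ}
    (hh : ((κ * t : ℝ) : EReal) < P.val h) : h ∈ orderFil K l 0 0 (t + 1) := by
  intro α hα
  have := hh.trans_le (val_le_of_coeff_ne_zero hP hα)
  rw [EReal.coe_lt_coe_iff, mul_lt_mul_iff_right₀ hP.pos, Int.cast_lt] at this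
  rw [sub_zero, sub_zero]
  exact this

theorem val_eq (hP : P.IsScaledOrder l κ) {h : MvPowerSeries (Fin 2) K} {t : ℤ}
    (hh : h ∈ orderFil K l 0 0 t) (hh' : h ∉ orderFil K l 0 0 (t + 1)) :
    P.val h = ((κ * t : ℝ) : EReal) :=
  le_antisymm (not_lt.1 fun hlt => hh' (mem_of_lt_val hP hlt)) (le_val_of_mem hP hh)

variable {ξ : Derivation K (MvPowerSeries (Fin 2) K) (MvPowerSeries (Fin 2) K)} {t : ℤ}

theorem le_derVal_of_mem (hP : P.IsScaledOrder l κ) (h0 : ξ (X 0) ∈ orderFil K l 1 0 t)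
    (h1 : ξ (X 1) ∈ orderFil K l 0 1 t) : ((κ * t : ℝ) : EReal) ≤ P.derVal ξ := by
  refine le_iInf fun i => le_iInf₂ fun α hα => ?_
  fin_cases i
  · rw [hP.denom_mul_lam (α 0 - 1) (α 1 - 0) _ (by simp) (by simp), EReal.coe_le_coe_iff]
    exact mul_le_mul_of_nonneg_left (by exact_mod_cast h0 α hα) hP.pos.le
  · rw [hP.denom_mul_lam (α 0 - 0) (α 1 - 1) _ (by simp) (by simp), EReal.coe_le_coe_iff]
    exact mul_le_mul_of_nonneg_left (by exact_mod_cast h1 α hα) hP.pos.le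

theorem mem_left_of_lt_derVal (hP : P.IsScaledOrder l κ)
    (hh : ((κ * t : ℝ) : EReal) < P.derVal ξ) : ξ (X 0) ∈ orderFil K l 1 0 (t + 1) := by
  intro α hα
  have := hh.trans_le ((iInf_le _ 0).trans (iInf₂_le α hα))
  rw [hP.denom_mul_lam (α 0 - 1) (α 1 - 0) _ (by simp) (by simp), EReal.coe_lt_coe_iff,
    mul_lt_mul_iff_right₀ hP.pos, Int.cast_lt] at this
  exact this

theorem mem_right_of_lt_derVal (hP : P.IsScaledOrder l κ)
    (hh : ((κ * t : ℝ) : EReal) < P.derVal ξ) : ξ (X 1) ∈ orderFil K l 0 1 (t + 1) := by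
  intro α hα
  have := hh.trans_le ((iInf_le _ 1).trans (iInf₂_le α hα))
  rw [hP.denom_mul_lam (α 0 - 0) (α 1 - 1) _ (by simp) (by simp), EReal.coe_lt_coe_iff,
    mul_lt_mul_iff_right₀ hP.pos, Int.cast_lt] at this
  exact this

theorem coe_sub_lt_of_coe_lt_add {x d : ℝ} {v : EReal} (h : (x : EReal) < v + d) :
    ((x - d : ℝ) : EReal) < v := by
  induction v with
  | bot => simp at h
  | top => exact EReal.coe_lt_top _
  | coe v =>
    rw [← EReal.coe_add, EReal.coe_lt_coe_iff] at h
    rw [EReal.coe_lt_coe_iff]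
    linarith

theorem exists_mem_notMem_orderFil (hl : IsPlaneOrder l) {h : MvPowerSeries (Fin 2) K}
    (h0 : h ≠ 0) : ∃ k : ℕ, h ∈ orderFil K l 0 0 k ∧ h ∉ orderFil K l 0 0 (k + 1) := by
  by_contra! hcon
  refine h0 (eq_zero_of_forall_mem_orderFil (l := l) (i := 0) (j := 0) fun k => ?_)
  induction k with
  | zero => exact mem_orderFil_zero hl h
  | succ k ih => exact_mod_cast hcon k ih

/-- Condition AC holds if the leading part of every element of the Tjurina ideal comes from the
tangent space at `f`. -/
theorem satisfiesAC_of_mem_leadingTangent (hl : IsPlaneOrder l) (hP : P.IsScaledOrder l κ) {d : ℤ}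
    {f : MvPowerSeries (Fin 2) K} (hf : f ∈ orderFil K l 0 0 d) (hf' : f ∉ orderFil K l 0 0 (d + 1))
    (H : ∀ h ∈ tjurinaIdeal f, ∀ t, h ∈ orderFil K l 0 0 t → h ∈ leadingTangent l d f t) :
    P.SatisfiesAC f := by
  intro h hh h0
  obtain ⟨k, hk, hk'⟩ := exists_mem_notMem_orderFil hl h0
  obtain ⟨g, hg, a, ha, b, hb, e⟩ := H h hh k hk
  set ξ : Derivation K (MvPowerSeries (Fin 2) K) (MvPowerSeries (Fin 2) K) :=
    a • pderiv K 0 + b • pderiv K 1 with hξ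
  have ξ_apply : ∀ w, ξ w = a * pderiv K 0 w + b * pderiv K 1 w := fun _ => rfl
  have ξ0 : ξ (X 0) = a := by
    rw [ξ_apply, pderiv_X_self, pderiv_X_of_ne (by decide), mul_one, mul_zero, add_zero]
  have ξ1 : ξ (X 1) = b := by
    rw [ξ_apply, pderiv_X_self, pderiv_X_of_ne (by decide), mul_one, mul_zero, zero_add]
  have e' : h - g * f - ξ f ∈ orderFil K l 0 0 (k + 1) := by
    convert e using 1
    rw [ξ_apply]
    ring
  have hval := val_eq hP hf hf'
  have hcast : ((κ * (k : ℤ) : ℝ) : EReal) = ((κ * (k - d : ℤ) : ℝ) : EReal) + P.val f := by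
    rw [hval, ← EReal.coe_add]
    congr 1
    push_cast
    ring
  have hmin : P.val h = min (P.val g + P.val f) (P.derVal ξ + P.val f) := by
    rw [val_eq hP hk hk']
    refine le_antisymm (le_min ?_ ?_) (not_lt.1 fun hlt => hk' ?_)
    · rw [hcast]
      exact add_le_add_left (le_val_of_mem hP hg) _
    · rw [hcast]
      exact add_le_add_left (le_derVal_of_mem hP (ξ0.symm ▸ ha) (ξ1.symm ▸ hb)) _
    -- If `g` and `ξ` both had larger valuation, `g * f` and `ξ f`, hence `h`, would have order
    -- above `k`.
    · rw [lt_min_iff, hval] at hlt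
      have e0 : κ * (k : ℤ) - κ * d = κ * (k - d : ℤ) := by push_cast; ring
      have hg' := coe_sub_lt_of_coe_lt_add hlt.1
      have hξ' := coe_sub_lt_of_coe_lt_add hlt.2
      rw [e0] at hg' hξ'
      have m0 := mem_of_lt_val hP hg'
      have m1 := mem_left_of_lt_derVal hP hξ'
      have m2 := mem_right_of_lt_derVal hP hξ'
      rw [ξ0] at m1
      rw [ξ1] at m2
      have := add_mem e' (add_mem (mul_mem_orderFil' (i'' := 0) (j'' := 0) hl m0 hf)
        (add_mem (mul_mem_orderFil' (i'' := 0) (j'' := 0) hl m1 (pderiv_zero_mem_orderFil hf))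
        (mul_mem_orderFil' (i'' := 0) (j'' := 0) hl m2 (pderiv_one_mem_orderFil hf))))
      convert this using 1
      rw [ξ_apply]
      ring
  refine ⟨g, ξ, hmin, hmin ▸ ?_⟩
  rw [val_eq hP hk hk']
  refine lt_of_lt_of_le ?_ (le_val_of_mem hP e')
  rw [EReal.coe_lt_coe_iff, mul_lt_mul_iff_right₀ hP.pos, Int.cast_lt]
  exact lt_add_one _

end CPolytope

end valuation

end

/-! ### Contact equivalence and the exact determinacy. -/

section

section ContactEquiv

variable {K : Type*} [Field K] {n : ℕ} {f g h : MvPowerSeries (Fin n) K}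

theorem ContactEquiv.symm (H : ContactEquiv f g) : ContactEquiv g f := by
  obtain ⟨φ, u, rfl⟩ := H
  refine ⟨φ.symm, Units.map (φ.symm : MvPowerSeries (Fin n) K →* MvPowerSeries (Fin n) K) u⁻¹, ?_⟩
  rw [map_mul, ← mul_assoc, Units.coe_map, MonoidHom.coe_coe, ← map_mul, Units.inv_mul, map_one,
    one_mul, AlgEquiv.symm_apply_apply]

theorem ContactEquiv.trans (H : ContactEquiv f g) (H' : ContactEquiv g h) : ContactEquiv f h := by
  obtain ⟨φ, u, rfl⟩ := H
  obtain ⟨ψ, v, rfl⟩ := H'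
  refine ⟨ψ.trans φ, u * Units.map (φ : MvPowerSeries (Fin n) K →* MvPowerSeries (Fin n) K) v, ?_⟩
  rw [map_mul, ← mul_assoc, Units.val_mul, Units.coe_map, MonoidHom.coe_coe, AlgEquiv.trans_apply]

/-- Automorphisms preserve non-units, and these form the maximal ideal; no continuity is needed. -/
theorem constantCoeff_algEquiv_eq_zero
    (φ : MvPowerSeries (Fin n) K ≃ₐ[K] MvPowerSeries (Fin n) K) (hf : constantCoeff f = 0) :
    constantCoeff (φ f) = 0 := by
  by_contra h0
  have h1 : IsUnit (φ f) := isUnit_iff_constantCoeff.2 (isUnit_iff_ne_zero.2 h0)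
  rw [MulEquiv.isUnit_map, isUnit_iff_constantCoeff, hf] at h1
  exact not_isUnit_zero h1

/-- Contact determinacy is invariant: if `f ∼ g`, `f` is `k`-determined and `z` lies in the maximal
ideal, then subtracting `z ^ m` with `k < m` from `g` does not leave the class of `g`. -/
theorem ContactDetermined.contactEquiv_sub_pow {k m : ℕ} (hf : ContactDetermined k f)
    (hfg : ContactEquiv f g) (hkm : k < m) {z : MvPowerSeries (Fin n) K}
    (hz : constantCoeff z = 0) : ContactEquiv g (g - z ^ m) := by
  refine hfg.symm.trans ?_
  obtain ⟨φ, u, rfl⟩ := hfg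
  -- This series differs from `f` by `u * φ z ^ m`, of order at least m > k.
  refine (hf (u * φ (g - z ^ m)) fun α hα => ?_).trans ⟨φ, u, rfl⟩
  rw [map_sub, mul_sub, map_sub, sub_eq_self, map_pow]
  refine coeff_of_lt_order (lt_of_lt_of_le ?_ le_order_mul)
  refine lt_of_lt_of_le ?_ le_add_self
  refine lt_of_lt_of_le ?_
    (le_order_pow_of_constantCoeff_eq_zero m (constantCoeff_algEquiv_eq_zero φ hz))
  exact_mod_cast hα.trans_lt hkm

end ContactEquiv

section squareFactor

variable {K : Type*} [Field K] {p q : ℕ} {c : K}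

theorem prime_X_zero : Prime (X 0 : MvPowerSeries (Fin 2) K) := by
  have : IsDomain (MvPowerSeries (Fin 1) K) := NoZeroDivisors.to_isDomain _
  rw [← MulEquiv.prime_iff (finSuccEquiv K 1), finSuccEquiv_X_zero]
  exact PowerSeries.X_prime

theorem prime_X_one : Prime (X 1 : MvPowerSeries (Fin 2) K) := by
  rw [← MulEquiv.prime_iff (renameEquiv K (Equiv.swap (0 : Fin 2) 1))]
  simpa using prime_X_zero

theorem not_X_zero_dvd_X_one : ¬ (X 0 : MvPowerSeries (Fin 2) K) ∣ X 1 := by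
  intro h
  have := X_dvd_iff.1 h (Finsupp.single 1 1) (by simp)
  simp at this

theorem X_zero_eq_term : (X 0 : MvPowerSeries (Fin 2) K) = term 1 0 1 := by
  rw [← X_pow_eq_term_zero, pow_one]

theorem X_one_eq_term : (X 1 : MvPowerSeries (Fin 2) K) = term 0 1 1 := by
  rw [← X_pow_eq_term_one, pow_one]

theorem pderiv_zero_tpq_add_two (p q : ℕ) (c : K) : pderiv K 0 (tpq (p + 2) (q + 2) c) =
    X 0 * (((p + 2 : ℕ) : K) • X 0 ^ p + (2 * c) • X 1 ^ 2) := by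
  rw [pderiv_zero_tpq, X_pow_eq_term_zero, X_pow_eq_term_one, X_zero_eq_term,
    smul_term, smul_term, mul_add, term_mul_term, term_mul_term]
  congr 2 <;> simp [add_comm]

theorem pderiv_one_tpq_add_two (p q : ℕ) (c : K) : pderiv K 1 (tpq (p + 2) (q + 2) c) =
    X 1 * ((2 * c) • X 0 ^ 2 + ((q + 2 : ℕ) : K) • X 1 ^ q) := by
  rw [pderiv_one_tpq, X_pow_eq_term_zero, X_pow_eq_term_one, X_one_eq_term,
    smul_term, smul_term, mul_add, term_mul_term, term_mul_term]
  congr 2 <;> simp [add_comm]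

/-- A common prime divides neither x nor y, since through the series itself it would divide both. So
it divides the cofactors of x and y in the partial derivatives, which give y² ≡ a x^(p-2) and x² ≡ b
y^(q-2). Substituting one into the other, it divides y⁴ times a unit. This also covers a = 0 or b =
0. -/
theorem not_prime_dvd_tpq_and_pderiv (h : 2 * (p + q) < p * q) (h2 : (2 : K) ≠ 0) (hc : c ≠ 0)
    {z : MvPowerSeries (Fin 2) K} (hz : Prime z) (hf : z ∣ tpq p q c)
    (hx : z ∣ pderiv K 0 (tpq p q c)) (hy : z ∣ pderiv K 1 (tpq p q c)) : False := by
  obtain ⟨p, rfl⟩ : ∃ p', p = p' + 2 := ⟨p - 2, by have := three_le_left_of_lt h; omega⟩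
  obtain ⟨q, rfl⟩ : ∃ q', q = q' + 2 := ⟨q - 2, by have := three_le_right_of_lt h; omega⟩
  -- With exponents lowered by 2, the hypothesis reads (p-2)(q-2) > 4.
  have hpq : 4 < p * q := by nlinarith
  rw [pderiv_zero_tpq_add_two] at hx
  rw [pderiv_one_tpq_add_two] at hy
  have hxy : z ∣ X 0 → z ∣ X 1 → False := by
    intro h0 h1
    rw [hz.dvd_prime_iff_associated prime_X_zero] at h0
    exact not_X_zero_dvd_X_one (h0.symm.dvd.trans h1)
  have of_left : z ∣ X 0 → False := by
    intro h0
    refine hxy h0 (hz.dvd_of_dvd_pow (n := q + 2) ?_)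
    rw [tpq] at hf
    refine (dvd_add_right ?_).1 hf
    exact dvd_add (dvd_pow h0 (by omega)) ((dvd_mul_of_dvd_right (dvd_pow h0 two_ne_zero) _).mul_right _)
  have of_right : z ∣ X 1 → False := by
    intro h1
    refine hxy (hz.dvd_of_dvd_pow (n := p + 2) ?_) h1
    rw [tpq, add_assoc] at hf
    refine (dvd_add_left ?_).1 hf
    exact dvd_add (dvd_mul_of_dvd_right (dvd_pow h1 two_ne_zero) _) (dvd_pow h1 (by omega))
  have hx' := (hz.dvd_or_dvd hx).resolve_left of_left
  have hy' := (hz.dvd_or_dvd hy).resolve_left of_right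
  obtain ⟨a, ha⟩ : ∃ a : K, a = -((p + 2 : ℕ) : K) / (2 * c) := ⟨_, rfl⟩
  obtain ⟨b, hb⟩ : ∃ b : K, b = -((q + 2 : ℕ) : K) / (2 * c) := ⟨_, rfl⟩
  have h2c : 2 * c ≠ 0 := mul_ne_zero h2 hc
  have d1 : z ∣ X 1 ^ 2 - a • X 0 ^ p := by
    have := dvd_smul_of_dvd (2 * c)⁻¹ hx'
    convert this using 1
    rw [smul_add, smul_smul, smul_smul, inv_mul_cancel₀ h2c, one_smul, ha, sub_eq_add_neg,
      ← neg_smul, add_comm]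
    congr 2
    ring
  have d2 : z ∣ X 0 ^ 2 - b • X 1 ^ q := by
    have := dvd_smul_of_dvd (2 * c)⁻¹ hy'
    convert this using 1
    rw [smul_add, smul_smul, smul_smul, inv_mul_cancel₀ h2c, one_smul, hb, sub_eq_add_neg,
      ← neg_smul]
    congr 2
    ring
  have d3 := d1.trans (sub_dvd_pow_sub_pow _ _ 2)
  have d4 := d2.trans (sub_dvd_pow_sub_pow _ _ p)
  have d5 : z ∣ X 1 ^ 4 * (1 - (a ^ 2 * b ^ p) • X 1 ^ (p * q - 4)) := by
    convert dvd_add d3 (dvd_smul_of_dvd (a ^ 2) d4) using 1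
    have e : (X 1 : MvPowerSeries (Fin 2) K) ^ (q * p) = X 1 ^ 4 * X 1 ^ (p * q - 4) := by
      rw [← pow_add]
      congr 1
      rw [mul_comm]
      omega
    simp only [smul_pow, ← pow_mul, smul_sub, smul_smul, e]
    rw [mul_sub, mul_one, mul_smul_comm, mul_comm p 2]
    ring
  rcases hz.dvd_or_dvd d5 with d | d
  · exact of_right (hz.dvd_of_dvd_pow d)
  · refine hz.not_isUnit (isUnit_of_dvd_unit d (isUnit_iff_constantCoeff.2 ?_))
    have : p * q - 4 ≠ 0 := by omega
    simp [smul_eq_C_mul, this]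

/-- A prime whose square divides a series divides its partial derivatives too. -/
theorem not_contactEquiv_tpq_sq_mul (h : 2 * (p + q) < p * q) (h2 : (2 : K) ≠ 0) (hc : c ≠ 0)
    {w : MvPowerSeries (Fin 2) K} (hw : Prime w) (g : MvPowerSeries (Fin 2) K) :
    ¬ ContactEquiv (tpq p q c) (w ^ 2 * g) := by
  rintro ⟨φ, u, e⟩
  have hz : Prime (φ w) := (MulEquiv.prime_iff φ).2 hw
  obtain ⟨v, hv⟩ : ∃ v, tpq p q c = φ w ^ 2 * v := ⟨u * φ g, by rw [e, map_mul, map_pow]; ring⟩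
  have hd : ∀ i, φ w ∣ pderiv K i (tpq p q c) := by
    intro i
    rw [hv, Derivation.leibniz, Derivation.leibniz_pow]
    refine dvd_add ((dvd_pow_self _ two_ne_zero).mul_right _) (dvd_mul_of_dvd_right ?_ _)
    simp only [Nat.add_one_sub_one, pow_one, smul_eq_mul, nsmul_eq_mul]
    exact ((dvd_refl _).mul_right _).mul_left _
  exact not_prime_dvd_tpq_and_pderiv h h2 hc hz (hv ▸ (dvd_pow_self _ two_ne_zero).mul_right _)
    (hd 0) (hd 1)

theorem lt_tpqOrder_of_lt_add (h : 2 * (p + q) < p * q) {a b : ℕ} (hp : p < a + b)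
    (hq : q < a + b) : (2 * p * q : ℤ) < tpqOrder p q a b := by
  have aux : ∀ p q a b : ℕ, 2 * (p + q) < p * q → p < a + b → q < a + b →
      (2 * p : ℤ) < 2 * a + (p - 2) * b := by
    intro p q a b h hp hq
    have hp3 := three_le_left_of_lt h
    -- For p ≥ 4 the form is 2(a+b) + (p-4)b. For p = 3 the hypothesis gives q > 6, hence a + b ≥ 8.
    rcases hp3.eq_or_lt with rfl | hp4
    · push_cast
      omega
    · have : (0 : ℤ) ≤ (p - 4) * b := mul_nonneg (by omega) (by omega)
      linarith [show (p : ℤ) < a + b by exact_mod_cast hp]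
  have hp0 : (0 : ℤ) < p := by have := three_le_left_of_lt h; omega
  have hq0 : (0 : ℤ) < q := by have := three_le_right_of_lt h; omega
  refine lt_min ?_ ?_
  · linarith [mul_lt_mul_of_pos_left (aux p q a b h hp hq) hq0]
  · linarith [mul_lt_mul_of_pos_left
      (aux q p b a (by linarith [mul_comm p q]) (by omega) (by omega)) hp0]

theorem hasContactDeterminacy_of_sub_tpq_mem (h : 2 * (p + q) < p * q) (h2 : (2 : K) ≠ 0)
    (hc : c ≠ 0) {f : MvPowerSeries (Fin 2) K}
    (hf : f - tpq p q c ∈ orderFil K (tpqOrder p q) 0 0 (2 * p * q + 1)) :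
    HasContactDeterminacy f (max p q) := by
  have hft := contactEquiv_tpq h h2 hc hf
  have hp3 := three_le_left_of_lt h
  have hq3 := three_le_right_of_lt h
  refine ⟨fun g hg => hft.trans (contactEquiv_tpq h h2 hc fun α hα => ?_).symm, fun k hk => ?_⟩
  · rcases le_or_gt α.degree (max p q) with hle | hlt
    · rw [map_sub, hg α hle, ← map_sub] at hα
      exact hf α hα
    · rw [Finsupp.degree_eq_sum, Fin.sum_univ_two, max_lt_iff] at hlt
      rw [sub_zero, sub_zero]
      exact lt_tpqOrder_of_lt_add h hlt.1 hlt.2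
  · by_contra hlt
    rw [not_le, lt_max_iff] at hlt
    have hk : ContactDetermined k f := hk
    rcases hlt with hlt | hlt
    -- If k < p, removing x^p would stay in the contact class but leave y²(cx² + y^(q-2)).
    · refine not_contactEquiv_tpq_sq_mul h h2 hc prime_X_one (C c * X 0 ^ 2 + X 1 ^ (q - 2)) ?_
      convert hk.contactEquiv_sub_pow hft hlt (z := X 0) (by simp) using 1
      obtain ⟨q, rfl⟩ : ∃ q', q = q' + 2 := ⟨q - 2, by omega⟩
      rw [tpq, Nat.add_sub_cancel]
      ring
    · refine not_contactEquiv_tpq_sq_mul h h2 hc prime_X_zero (C c * X 1 ^ 2 + X 0 ^ (p - 2)) ?_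
      convert hk.contactEquiv_sub_pow hft hlt (z := X 1) (by simp) using 1
      obtain ⟨p, rfl⟩ : ∃ p', p = p' + 2 := ⟨p - 2, by omega⟩
      rw [tpq, Nat.add_sub_cancel]
      ring

end squareFactor

end

/-! ### Compact faces of the Newton polyhedron and the exponents of the principal part. -/

section

/-- The open half-space {l > m} together with the hull of the generators on {l = m} is convex and
contains `G`. -/
theorem convexHull_inter_subset {E : Type*} [AddCommGroup E] [Module ℝ E] (l : E →ₗ[ℝ] ℝ)
    {G : Set E} {m : ℝ} (hm : ∀ g ∈ G, m ≤ l g) :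
    {r ∈ convexHull ℝ G | l r = m} ⊆ convexHull ℝ {g ∈ G | l g = m} := by
  set H := convexHull ℝ {g ∈ G | l g = m} with hH
  have hHm : ∀ r ∈ H, l r = m := by
    intro r hr
    exact convexHull_min (t := {r | l r = m}) (fun g hg => hg.2)
      (convex_hyperplane l.isLinear m) hr
  have hconv : Convex ℝ ({r | m < l r} ∪ H) := by
    intro x hx y hy a b ha hb hab
    have hle : ∀ z ∈ {r | m < l r} ∪ H, m ≤ l z := by
      rintro z (hz | hz)
      · exact hz.le
      · exact (hHm z hz).ge
    by_cases hxy : x ∈ H ∧ y ∈ H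
    · exact Or.inr (convex_convexHull ℝ _ hxy.1 hxy.2 ha hb hab)
    rcases ha.eq_or_lt with rfl | ha
    · rw [zero_add] at hab
      rw [hab, zero_smul, one_smul, zero_add]
      exact hy
    rcases hb.eq_or_lt with rfl | hb
    · rw [add_zero] at hab
      rw [hab, zero_smul, one_smul, add_zero]
      exact hx
    left
    have h1 := hle x hx
    have h2 := hle y hy
    have hm' : m = a * m + b * m := by rw [← add_mul, hab, one_mul]
    rw [Set.mem_ofPred_eq, map_add, map_smul, map_smul, smul_eq_mul, smul_eq_mul, hm']
    rcases hx with hx | hx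
    · exact add_lt_add_of_lt_of_le (mul_lt_mul_of_pos_left hx ha)
        (mul_le_mul_of_nonneg_left h2 hb.le)
    · have hy' : m < l y := hy.resolve_right fun hy => hxy ⟨hx, hy⟩
      exact add_lt_add_of_le_of_lt (mul_le_mul_of_nonneg_left h1 ha.le)
        (mul_lt_mul_of_pos_left hy' hb)
  rintro r ⟨hr, hrm⟩
  have hGr : G ⊆ {r | m < l r} ∪ H := by
    intro g hg
    rcases (hm g hg).lt_or_eq with h | h
    · exact Or.inl h
    · exact Or.inr (subset_convexHull ℝ _ ⟨hg, h.symm⟩)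
  rcases convexHull_min hGr hconv hr with h | h
  · exact absurd hrm h.ne'
  · exact h

section newtonPolyhedron

variable {K : Type*} [Field K] {n : ℕ} {f : MvPowerSeries (Fin n) K}

/-- The generators of the Newton polyhedron. -/
def newtonGenerators (f : MvPowerSeries (Fin n) K) : Set (Fin n → ℝ) :=
  {r | ∃ α : Fin n →₀ ℕ, coeff α f ≠ 0 ∧ ∀ j, (α j : ℝ) ≤ r j}

theorem exponent_mem_newtonGenerators {α : Fin n →₀ ℕ} (hα : coeff α f ≠ 0) :
    (fun j => (α j : ℝ)) ∈ newtonGenerators f := ⟨α, hα, fun _ => le_rfl⟩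

theorem add_mem_newtonPolyhedron {r v : Fin n → ℝ} (hr : r ∈ newtonPolyhedron f) (hv : 0 ≤ v) :
    r + v ∈ newtonPolyhedron f := by
  have hconv : Convex ℝ ((fun z => z + v) ⁻¹' newtonPolyhedron f) :=
    (convex_convexHull ℝ _).translate_preimage_left v
  refine convexHull_min ?_ hconv hr
  rintro g ⟨α, hα, hg⟩
  exact subset_convexHull ℝ _ ⟨α, hα, fun j => (hg j).trans (le_add_of_nonneg_right (hv j))⟩

/-- A compact exposed face of the Newton polyhedron is the convex hull of exponents of `f`. -/
theorem compact_face_subset_convexHull {A : Set (Fin n → ℝ)}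
    (hA : IsExposed ℝ (newtonPolyhedron f) A) (hc : IsCompact A) :
    A ⊆ convexHull ℝ {r ∈ A | ∃ α : Fin n →₀ ℕ, coeff α f ≠ 0 ∧ r = fun j => (α j : ℝ)} := by
  intro r hr
  obtain ⟨l, rfl⟩ := hA ⟨r, hr⟩
  -- The polyhedron is stable under upward translation, so the value is at most 0; equality would
  -- put a whole ray into the compact face.
  have hneg : ∀ j, l (Pi.single j 1) < 0 := by
    intro j
    have hmem : ∀ t : ℝ, 0 ≤ t → r + t • Pi.single j 1 ∈ newtonPolyhedron f := fun t ht =>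
      add_mem_newtonPolyhedron hr.1 (smul_nonneg ht (Pi.single_nonneg.2 zero_le_one))
    have hle : l (Pi.single j 1) ≤ 0 := by
      have := hr.2 _ (hmem 1 zero_le_one)
      rw [one_smul, map_add] at this
      linarith
    refine hle.lt_of_ne fun h0 => ?_
    obtain ⟨M, hM⟩ := hc.isBounded.exists_norm_le
    have hMj : ∀ t : ℝ, 0 ≤ t → |r j + t| ≤ M := by
      intro t ht
      have h1 : r + t • Pi.single j 1 ∈ {x ∈ newtonPolyhedron f |
          ∀ y ∈ newtonPolyhedron f, l y ≤ l x} := by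
        refine ⟨hmem t ht, fun y hy => ?_⟩
        rw [map_add, map_smul, h0, smul_zero, add_zero]
        exact hr.2 y hy
      have h2 := (norm_le_pi_norm (r + t • Pi.single j (1 : ℝ)) j).trans (hM _ h1)
      simpa using h2
    have h3 := hMj (|r j| + |M| + 1) (by positivity)
    have h4 := le_abs_self (r j + (|r j| + |M| + 1))
    have h5 := neg_abs_le (r j)
    have h6 := le_abs_self M
    linarith
  have hface := convexHull_inter_subset (-(l : (Fin n → ℝ) →ₗ[ℝ] ℝ)) (G := newtonGenerators f)
    (m := -l r) (fun g hg => by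
      simpa using hr.2 g (subset_convexHull ℝ _ hg)) ⟨hr.1, rfl⟩
  refine convexHull_mono ?_ hface
  rintro g ⟨⟨α, hα, hg⟩, hlg⟩
  have hlg : l g = l r := by simpa using hlg
  -- A generator strictly above its exponent would have a smaller value of `l` than that exponent.
  have hgα : g = fun j => (α j : ℝ) := by
    by_contra hne
    obtain ⟨j, hj⟩ := Function.ne_iff.1 hne
    have h1 : l (g - fun j => (α j : ℝ)) < 0 := by
      rw [pi_eq_sum_univ (g - fun j => (α j : ℝ)), map_sum]
      refine Finset.sum_neg' (fun i _ => ?_) ⟨j, Finset.mem_univ j, ?_⟩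
      · have e : (fun k => if i = k then (1 : ℝ) else 0) = Pi.single i 1 := by
          ext k
          rw [Pi.single_apply]
          exact if_congr eq_comm rfl rfl
        rw [map_smul, smul_eq_mul, e]
        exact mul_nonpos_of_nonneg_of_nonpos (sub_nonneg.2 (hg i)) (hneg i).le
      · have e : (fun k => if j = k then (1 : ℝ) else 0) = Pi.single j 1 := by
          ext k
          rw [Pi.single_apply]
          exact if_congr eq_comm rfl rfl
        rw [map_smul, smul_eq_mul, e]
        exact mul_neg_of_pos_of_neg (sub_pos.2 ((hg j).lt_of_ne hj.symm)) (hneg j)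
    rw [map_sub, hlg] at h1
    have h2 := hr.2 _ (subset_convexHull ℝ _ (exponent_mem_newtonGenerators hα))
    linarith
  refine ⟨⟨subset_convexHull ℝ _ ⟨α, hα, hg⟩, fun y hy => ?_⟩, α, hα, hgα⟩
  rw [hlg]
  exact hr.2 y hy

end newtonPolyhedron

namespace CPolytope

section lam

variable {n : ℕ} {P : CPolytope n} {w : Fin n → ℚ}

theorem lam_le (hw : w ∈ P.weights) (r : Fin n → ℝ) : P.lam r ≤ ∑ j, (w j : ℝ) * r j :=
  Finset.inf'_le (fun w : Fin n → ℚ => ∑ j, (w j : ℝ) * r j) hw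

theorem exists_lam_eq (P : CPolytope n) (r : Fin n → ℝ) :
    ∃ w ∈ P.weights, P.lam r = ∑ j, (w j : ℝ) * r j :=
  Finset.exists_mem_eq_inf' P.nonempty fun w : Fin n → ℚ => ∑ j, (w j : ℝ) * r j

theorem lam_smul (P : CPolytope n) {t : ℝ} (ht : 0 ≤ t) (r : Fin n → ℝ) :
    P.lam (t • r) = t * P.lam r := by
  have e : ∀ w : Fin n → ℚ, ∑ j, (w j : ℝ) * (t • r) j = t * ∑ j, (w j : ℝ) * r j := by
    intro w
    rw [Finset.mul_sum]
    exact Finset.sum_congr rfl fun j _ => by rw [Pi.smul_apply, smul_eq_mul]; ring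
  obtain ⟨w, hw, h1⟩ := P.exists_lam_eq r
  obtain ⟨w', hw', h2⟩ := P.exists_lam_eq (t • r)
  refine le_antisymm ?_ ?_
  · rw [h1, ← e]
    exact lam_le hw _
  · rw [h2, e]
    exact mul_le_mul_of_nonneg_left (lam_le hw' r) ht

theorem denom_pos (P : CPolytope n) : 0 < P.denom := by
  refine Nat.pos_of_ne_zero fun h => ?_
  rw [denom, Finset.lcm_eq_zero_iff] at h
  obtain ⟨w, -, hw⟩ := h
  rw [Finset.lcm_eq_zero_iff] at hw
  obtain ⟨j, -, hj⟩ := hw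
  exact (w j).den_ne_zero hj

variable {K : Type*} [Field K] {f : MvPowerSeries (Fin n) K}

theorem lam_le_lam_of_coeff_initialForm_ne_zero {α β : Fin n →₀ ℕ}
    (hα : coeff α (P.initialForm f) ≠ 0) (hβ : coeff β f ≠ 0) :
    P.lam (fun j => (α j : ℝ)) ≤ P.lam (fun j => (β j : ℝ)) := by
  by_contra h
  exact hα (if_neg fun H => h (H β hβ))

theorem coeff_initialForm_of_ne_zero {α : Fin n →₀ ℕ}
    (hα : coeff α (P.initialForm f) ≠ 0) : coeff α (P.initialForm f) = coeff α f := by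
  by_cases H : ∀ β : Fin n →₀ ℕ, coeff β f ≠ 0 →
      P.lam (fun j => (α j : ℝ)) ≤ P.lam (fun j => (β j : ℝ))
  · exact if_pos H
  · exact absurd (if_neg H) hα

theorem coeff_initialForm_of_lam_le {α β : Fin n →₀ ℕ} (hα : coeff α (P.initialForm f) ≠ 0)
    (hβ : P.lam (fun j => (β j : ℝ)) ≤ P.lam (fun j => (α j : ℝ))) :
    coeff β (P.initialForm f) = coeff β f :=
  if_pos fun _ hγ => hβ.trans (lam_le_lam_of_coeff_initialForm_ne_zero hα hγ)

end lam

section initialForm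

variable {K : Type*} [Field K] {n : ℕ} {P : CPolytope n} {f : MvPowerSeries (Fin n) K}

/-- If the principal part of `f` has finitely many terms, its exponents lie on the
Newton diagram and hence on `P`. -/
theorem lam_eq_one_of_coeff_initialForm_ne_zero (hP : P.carrier = newtonDiagram f)
    (hfin : {α | coeff α (P.initialForm f) ≠ 0}.Finite) {α : Fin n →₀ ℕ}
    (hα : coeff α (P.initialForm f) ≠ 0) : P.lam (fun j => (α j : ℝ)) = 1 := by
  obtain ⟨w, hw, hwα⟩ := P.exists_lam_eq fun j => (α j : ℝ)
  set m := P.lam (fun j => (α j : ℝ)) with hm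
  have hfα : coeff α f ≠ 0 := coeff_initialForm_of_ne_zero hα ▸ hα
  set l : (Fin n → ℝ) →L[ℝ] ℝ := ∑ j, (w j : ℝ) • ContinuousLinearMap.proj j with hl
  have l_apply : ∀ r, l r = ∑ j, (w j : ℝ) * r j := by
    intro r
    simp [hl]
  have hexp : ∀ β : Fin n →₀ ℕ, coeff β f ≠ 0 → m ≤ l fun j => (β j : ℝ) := by
    intro β hβ
    rw [l_apply]
    exact (lam_le_lam_of_coeff_initialForm_ne_zero hα hβ).trans (lam_le hw _)
  have hgen' : ∀ g (β : Fin n →₀ ℕ), (∀ j, (β j : ℝ) ≤ g j) → (l fun j => (β j : ℝ)) ≤ l g := by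
    intro g β hg
    rw [l_apply, l_apply]
    exact Finset.sum_le_sum fun j _ => mul_le_mul_of_nonneg_left (hg j)
      (by exact_mod_cast (P.pos w hw j).le)
  have hgen : ∀ g ∈ newtonGenerators f, m ≤ l g := by
    rintro g ⟨β, hβ, hg⟩
    exact (hexp β hβ).trans (hgen' g β hg)
  have hpoly : ∀ g ∈ newtonPolyhedron f, m ≤ l g := fun g hg =>
    convexHull_min (t := {g | m ≤ l g}) hgen
      (convex_halfSpace_ge (l : (Fin n → ℝ) →ₗ[ℝ] ℝ).isLinear m) hg
  have hmem : (fun j => (α j : ℝ)) ∈ {g ∈ newtonPolyhedron f | l g = m} :=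
    ⟨subset_convexHull ℝ _ (exponent_mem_newtonGenerators hfα), by rw [l_apply, ← hwα]⟩
  have hface : {g ∈ newtonPolyhedron f | l g = m} =
      convexHull ℝ {g ∈ newtonGenerators f | l g = m} := by
    refine (convexHull_inter_subset (l : (Fin n → ℝ) →ₗ[ℝ] ℝ) hgen).antisymm fun g hg => ⟨?_, ?_⟩
    · exact convexHull_mono (fun _ h => h.1) hg
    · exact convexHull_min (t := {g | l g = m}) (fun _ h => h.2)
        (convex_hyperplane (l : (Fin n → ℝ) →ₗ[ℝ] ℝ).isLinear m) hg
  -- The weights are positive, so generators minimising `l` are exponents, and they minimise λ_P.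
  -- Finiteness of the principal part then makes this face compact.
  have hsub : {g ∈ newtonGenerators f | l g = m} ⊆
      (fun (β : Fin n →₀ ℕ) j => (β j : ℝ)) '' {β | coeff β (P.initialForm f) ≠ 0} := by
    rintro g ⟨⟨β, hβ, hg⟩, hlg⟩
    have hle := hgen' g β hg
    have hge := hexp β hβ
    have hlβ : (l fun j => (β j : ℝ)) = m := le_antisymm (hle.trans hlg.le) hge
    refine ⟨β, ?_, ?_⟩
    · rw [Set.mem_ofPred_eq, coeff_initialForm_of_lam_le hα]
      · exact hβ
      · refine (lam_le hw _).trans ?_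
        rw [← l_apply, hlβ]
    · have h0 : ∑ j, (w j : ℝ) * (g j - β j) = 0 := by
        have : l (g - fun j => (β j : ℝ)) = 0 := by rw [map_sub, hlg, hlβ, sub_self]
        rwa [l_apply] at this
      rw [Finset.sum_eq_zero_iff_of_nonneg] at h0
      · ext j
        have hwj : (0 : ℝ) < w j := by exact_mod_cast P.pos w hw j
        have := (mul_eq_zero.1 (h0 j (Finset.mem_univ j))).resolve_left hwj.ne'
        linarith
      · exact fun j _ => mul_nonneg (by exact_mod_cast (P.pos w hw j).le) (sub_nonneg.2 (hg j))
  have hdiag : (fun j => (α j : ℝ)) ∈ newtonDiagram f := by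
    refine ⟨_, fun _ => ⟨-l, rfl⟩, ?_, ?_⟩
    · have e : {x ∈ newtonPolyhedron f | ∀ y ∈ newtonPolyhedron f, (-l) y ≤ (-l) x} =
          {g ∈ newtonPolyhedron f | l g = m} := by
        ext g
        refine and_congr_right fun hg => ⟨fun H => ?_, fun H y hy => ?_⟩
        · have h1 := H _ hmem.1
          rw [_root_.neg_apply, _root_.neg_apply, neg_le_neg_iff,
            hmem.2] at h1
          exact h1.antisymm (hpoly g hg)
        · rw [_root_.neg_apply, _root_.neg_apply, neg_le_neg_iff, H]
          exact hpoly y hy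
      rw [e, hface]
      exact ((hfin.image _).subset hsub).isCompact_convexHull ℝ
    · refine ⟨hmem.1, fun y hy => ?_⟩
      rw [_root_.neg_apply, _root_.neg_apply, neg_le_neg_iff, hmem.2]
      exact hpoly y hy
  rw [← hP] at hdiag
  exact hdiag.2

/-- Points of `P` are convex combinations of exponents of the principal part. -/
theorem carrier_subset_convexHull (hP : P.carrier = newtonDiagram f)
    (hfin : {α | coeff α (P.initialForm f) ≠ 0}.Finite) {α : Fin n →₀ ℕ}
    (hα : coeff α (P.initialForm f) ≠ 0) :
    P.carrier ⊆ convexHull ℝ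
      ((fun (β : Fin n →₀ ℕ) j => (β j : ℝ)) '' {β | coeff β (P.initialForm f) ≠ 0}) := by
  intro r hr
  rw [hP] at hr
  obtain ⟨A, hA, hc, hrA⟩ := hr
  refine convexHull_mono ?_ (compact_face_subset_convexHull hA hc hrA)
  rintro g ⟨hgA, β, hβ, rfl⟩
  refine ⟨β, ?_, rfl⟩
  have hg : (fun j => (β j : ℝ)) ∈ P.carrier := by
    rw [hP]
    exact ⟨A, hA, hc, hgA⟩
  rw [Set.mem_ofPred_eq, coeff_initialForm_of_lam_le hα]
  · exact hβ
  · rw [hg.2, lam_eq_one_of_coeff_initialForm_ne_zero hP hfin hα]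

end initialForm

end CPolytope

end

/-! ### Identification of λ_P with the order of the polygon. -/

section

section principalPart

variable {K : Type*} [Field K] {p q : ℕ} {c : K} {P : CPolytope 2} {f : MvPowerSeries (Fin 2) K}

theorem coeff_tpq_eq_zero {α : Fin 2 →₀ ℕ} (h1 : ¬ (α 0 = p ∧ α 1 = 0)) (h2 : ¬ (α 0 = 2 ∧ α 1 = 2))
    (h3 : ¬ (α 0 = 0 ∧ α 1 = q)) : coeff α (tpq p q c) = 0 := by
  rw [tpq_eq_term, map_add, map_add, coeff_term, coeff_term, coeff_term, if_neg h1, if_neg h2,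
    if_neg h3, add_zero, add_zero]

theorem eq_of_coeff_tpq_ne_zero {α : Fin 2 →₀ ℕ} (h : coeff α (tpq p q c) ≠ 0) :
    (α 0 = p ∧ α 1 = 0) ∨ (α 0 = 2 ∧ α 1 = 2) ∨ (α 0 = 0 ∧ α 1 = q) := by
  by_contra! hcon
  refine h (coeff_tpq_eq_zero ?_ ?_ ?_)
  · exact fun h => hcon.1 h.1 h.2
  · exact fun h => hcon.2.1 h.1 h.2
  · exact fun h => hcon.2.2 h.1 h.2

theorem coeff_tpq_left_ne_zero (h : 2 * (p + q) < p * q) :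
    coeff (Finsupp.single 0 p + Finsupp.single 1 0) (tpq p q c) ≠ 0 := by
  have := three_le_left_of_lt h
  rw [tpq_eq_term, map_add, map_add, coeff_term, coeff_term, coeff_term,
    single_add_single_apply_zero, single_add_single_apply_one, if_pos ⟨rfl, rfl⟩,
    if_neg (by omega), if_neg (by omega)]
  simp

theorem coeff_tpq_middle_ne_zero (hc : c ≠ 0) :
    coeff (Finsupp.single 0 2 + Finsupp.single 1 2) (tpq p q c) ≠ 0 := by
  rw [tpq_eq_term, map_add, map_add, coeff_term, coeff_term, coeff_term,
    single_add_single_apply_zero, single_add_single_apply_one, if_neg (by omega),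
    if_pos ⟨rfl, rfl⟩, if_neg (by omega)]
  simpa using hc

theorem coeff_tpq_right_ne_zero (h : 2 * (p + q) < p * q) :
    coeff (Finsupp.single 0 0 + Finsupp.single 1 q) (tpq p q c) ≠ 0 := by
  have := three_le_right_of_lt h
  rw [tpq_eq_term, map_add, map_add, coeff_term, coeff_term, coeff_term,
    single_add_single_apply_zero, single_add_single_apply_one, if_neg (by omega),
    if_neg (by omega), if_pos ⟨rfl, rfl⟩]
  simp

theorem finite_coeff_tpq_ne_zero : {α | coeff α (tpq p q c) ≠ 0}.Finite := by
  refine ((Set.finite_singleton _).insert _ |>.insert _).subset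
    (s := {Finsupp.single 0 p + Finsupp.single 1 0, Finsupp.single 0 2 + Finsupp.single 1 2,
      Finsupp.single 0 0 + Finsupp.single 1 q}) fun α hα => ?_
  rw [← single_add_single_eq α]
  rcases eq_of_coeff_tpq_ne_zero hα with h | h | h <;> simp [h.1, h.2]

theorem lam_eq_one_of_eq (hP : P.carrier = newtonDiagram f)
    (hf : P.initialForm f = tpq p q c) {a b : ℕ}
    (hab : coeff (Finsupp.single 0 a + Finsupp.single 1 b) (tpq p q c) ≠ 0) :
    P.lam ![(a : ℝ), (b : ℝ)] = 1 := by
  have := CPolytope.lam_eq_one_of_coeff_initialForm_ne_zero hP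
    (hf ▸ finite_coeff_tpq_ne_zero) (hf ▸ hab)
  convert this using 2
  ext j
  fin_cases j <;> simp

/-- The piecewise linear function of `P` lies below the two linear forms defining the edges of the
Newton polygon. -/
theorem lam_le_of_nonneg (h : 2 * (p + q) < p * q) (hc : c ≠ 0)
    (hP : P.carrier = newtonDiagram f) (hf : P.initialForm f = tpq p q c) {r : Fin 2 → ℝ}
    (hr : ∀ j, 0 ≤ r j) : 2 * p * q * P.lam r ≤ 2 * q * r 0 + q * (p - 2) * r 1 ∧
      2 * p * q * P.lam r ≤ p * (q - 2) * r 0 + 2 * p * r 1 := by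
  have hp3 : (3 : ℝ) ≤ p := by exact_mod_cast three_le_left_of_lt h
  have hq3 : (3 : ℝ) ≤ q := by exact_mod_cast three_le_right_of_lt h
  have hpq : (2 * (p + q) : ℝ) < p * q := by exact_mod_cast h
  have hp2 : (0 : ℝ) ≤ p - 2 := by linarith
  have hq2 : (0 : ℝ) ≤ q - 2 := by linarith
  have h0 := hr 0
  have h1 := hr 1
  rcases le_or_gt (P.lam r) 0 with hlam | hlam
  · have : 2 * p * q * P.lam r ≤ 0 := mul_nonpos_of_nonneg_of_nonpos (by positivity) hlam
    exact ⟨this.trans (by positivity), this.trans (by positivity)⟩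
  -- Rescaled onto `P`, the point lies in the triangle of the three vertices, where both edge forms
  -- are at least 2pq.
  set s : Fin 2 → ℝ := (P.lam r)⁻¹ • r with hs
  have hsP : s ∈ P.carrier := by
    refine ⟨fun j => mul_nonneg (by positivity) (hr j), ?_⟩
    rw [hs, P.lam_smul (by positivity), inv_mul_cancel₀ hlam.ne']
  have hfin : {α | coeff α (P.initialForm f) ≠ 0}.Finite := hf ▸ finite_coeff_tpq_ne_zero
  have hmem := CPolytope.carrier_subset_convexHull hP hfin
    (hf ▸ coeff_tpq_middle_ne_zero (p := p) (q := q) hc) hsP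
  have hconv : ∀ a b d : ℝ, Convex ℝ {z : Fin 2 → ℝ | d ≤ a * z 0 + b * z 1} := by
    intro a b d x hx y hy t u ht hu htu
    have hx : d ≤ a * x 0 + b * x 1 := hx
    have hy : d ≤ a * y 0 + b * y 1 := hy
    change d ≤ a * (t * x 0 + u * y 0) + b * (t * x 1 + u * y 1)
    have := mul_le_mul_of_nonneg_left hx ht
    have := mul_le_mul_of_nonneg_left hy hu
    have : d = t * d + u * d := by rw [← add_mul, htu, one_mul]
    linarith
  have key : ∀ a b : ℝ, (2 * p * q : ℝ) ≤ a * p → (2 * p * q : ℝ) ≤ a * 2 + b * 2 →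
      (2 * p * q : ℝ) ≤ b * q → 2 * p * q * P.lam r ≤ a * r 0 + b * r 1 := by
    intro a b e1 e2 e3
    have hin : s ∈ {z : Fin 2 → ℝ | (2 * p * q : ℝ) ≤ a * z 0 + b * z 1} := by
      refine convexHull_min ?_ (hconv _ _ _) hmem
      rintro _ ⟨α, hα, rfl⟩
      rw [hf] at hα
      change (2 * p * q : ℝ) ≤ a * (α 0 : ℝ) + b * (α 1 : ℝ)
      rcases eq_of_coeff_tpq_ne_zero hα with h | h | h <;> rw [h.1, h.2] <;> push_cast <;> linarith
    have hin : (2 * p * q : ℝ) ≤ a * ((P.lam r)⁻¹ * r 0) + b * ((P.lam r)⁻¹ * r 1) := hin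
    calc 2 * p * q * P.lam r
        ≤ (a * ((P.lam r)⁻¹ * r 0) + b * ((P.lam r)⁻¹ * r 1)) * P.lam r :=
          mul_le_mul_of_nonneg_right hin hlam.le
      _ = a * r 0 + b * r 1 := by field_simp
  have hp0 : (0 : ℝ) < p := by linarith
  have hq0 : (0 : ℝ) < q := by linarith
  refine ⟨key _ _ (by linarith) (by linarith) ?_, key _ _ ?_ (by linarith) (by linarith)⟩
  · have := mul_lt_mul_of_pos_left hpq hq0
    nlinarith
  · have := mul_lt_mul_of_pos_left hpq hp0
    nlinarith

/-- Both edge forms occur among the weights, and any further weight is at least their minimum on the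
orthant, so irredundancy excludes it. Knowing the weights themselves gives the formula for all `r`,
including those with negative entries. -/
theorem lam_eq (h : 2 * (p + q) < p * q) (hc : c ≠ 0)
    (hP : P.carrier = newtonDiagram f) (hf : P.initialForm f = tpq p q c) (r : Fin 2 → ℝ) :
    2 * p * q * P.lam r =
      min (2 * q * r 0 + q * (p - 2) * r 1) (p * (q - 2) * r 0 + 2 * p * r 1) := by
  have hp3 : (3 : ℝ) ≤ p := by exact_mod_cast three_le_left_of_lt h
  have hq3 : (3 : ℝ) ≤ q := by exact_mod_cast three_le_right_of_lt h
  have hp0 : (0 : ℝ) < p := by linarith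
  have hq0 : (0 : ℝ) < q := by linarith
  have hw : ∀ w ∈ P.weights, 1 ≤ (w 0 : ℝ) * p ∧ 1 ≤ (w 0 : ℝ) * 2 + w 1 * 2 ∧
      1 ≤ (w 1 : ℝ) * q := by
    intro w hw
    refine ⟨?_, ?_, ?_⟩
    · have := (lam_eq_one_of_eq hP hf (coeff_tpq_left_ne_zero h)).symm.le.trans
        (CPolytope.lam_le hw _)
      simpa [Fin.sum_univ_two] using this
    · have := (lam_eq_one_of_eq hP hf (coeff_tpq_middle_ne_zero hc)).symm.le.trans
        (CPolytope.lam_le hw _)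
      simpa [Fin.sum_univ_two] using this
    · have := (lam_eq_one_of_eq hP hf (coeff_tpq_right_ne_zero h)).symm.le.trans
        (CPolytope.lam_le hw _)
      simpa [Fin.sum_univ_two] using this
  obtain ⟨u, hu, hu0, hu1⟩ : ∃ u ∈ P.weights, (u 0 : ℝ) * p = 1 ∧ (u 0 : ℝ) * 2 + u 1 * 2 = 1 := by
    -- The test point is (p,0) + (2,2). A minimising weight has value at most 2 there and at least 1
    -- at each summand, so it equals 1 at both ends of the edge.
    obtain ⟨u, hu, e⟩ := P.exists_lam_eq ![(p : ℝ) + 2, 2]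
    have hle := (lam_le_of_nonneg h hc hP hf (r := ![(p : ℝ) + 2, 2]) (by
      intro j; fin_cases j <;> simp; positivity)).1
    rw [e, Fin.sum_univ_two] at hle
    simp only [Matrix.cons_val_zero, Matrix.cons_val_one] at hle
    have h1 : (u 0 : ℝ) * (p + 2) + u 1 * 2 ≤ 2 := by
      refine le_of_mul_le_mul_left (a := (2 * p * q : ℝ)) ?_ (by positivity)
      linarith
    obtain ⟨e1, e2, -⟩ := hw u hu
    exact ⟨u, hu, by linarith, by linarith⟩
  obtain ⟨v, hv, hv0, hv1⟩ : ∃ v ∈ P.weights, (v 1 : ℝ) * q = 1 ∧ (v 0 : ℝ) * 2 + v 1 * 2 = 1 := by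
    obtain ⟨v, hv, e⟩ := P.exists_lam_eq ![2, (q : ℝ) + 2]
    have hle := (lam_le_of_nonneg h hc hP hf (r := ![2, (q : ℝ) + 2]) (by
      intro j; fin_cases j <;> simp; positivity)).2
    rw [e, Fin.sum_univ_two] at hle
    simp only [Matrix.cons_val_zero, Matrix.cons_val_one] at hle
    have h1 : (v 0 : ℝ) * 2 + v 1 * (q + 2) ≤ 2 := by
      refine le_of_mul_le_mul_left (a := (2 * p * q : ℝ)) ?_ (by positivity)
      linarith
    obtain ⟨-, e2, e3⟩ := hw v hv
    exact ⟨v, hv, by linarith, by linarith⟩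
  have eu : ∀ r : Fin 2 → ℝ, 2 * p * q * ∑ j, (u j : ℝ) * r j =
      2 * q * r 0 + q * (p - 2) * r 1 := by
    intro r
    rw [Fin.sum_univ_two]
    linear_combination (2 * q * r 0 - 2 * q * r 1) * hu0 + p * q * r 1 * hu1
  have ev : ∀ r : Fin 2 → ℝ, 2 * p * q * ∑ j, (v j : ℝ) * r j =
      p * (q - 2) * r 0 + 2 * p * r 1 := by
    intro r
    rw [Fin.sum_univ_two]
    linear_combination (2 * p * r 1 - 2 * p * r 0) * hv0 + p * q * r 0 * hv1
  have hD : (0 : ℝ) ≤ 2 * p * q := by positivity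
  refine le_antisymm (le_min ?_ ?_) ?_
  · rw [← eu]
    exact mul_le_mul_of_nonneg_left (CPolytope.lam_le hu r) hD
  · rw [← ev]
    exact mul_le_mul_of_nonneg_left (CPolytope.lam_le hv r) hD
  obtain ⟨w, hwP, e⟩ := P.exists_lam_eq r
  rw [e]
  by_cases hwu : w = u
  · rw [hwu, eu]
    exact min_le_left _ _
  by_cases hwv : w = v
  · rw [hwv, ev]
    exact min_le_right _ _
  exfalso
  obtain ⟨s, hs, hlt⟩ := P.irredundant w hwP
  have h1 := mul_lt_mul_of_pos_left (hlt u hu (Ne.symm hwu)) (show (0 : ℝ) < 2 * p * q by positivity)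
  have h2 := mul_lt_mul_of_pos_left (hlt v hv (Ne.symm hwv)) (show (0 : ℝ) < 2 * p * q by positivity)
  rw [eu, Fin.sum_univ_two] at h1
  rw [ev, Fin.sum_univ_two] at h2
  obtain ⟨e1, e2, e3⟩ := hw w hwP
  -- In each cone `s` is a nonnegative combination of (2,2) and one outer vertex, so `w` is at least
  -- the corresponding edge form.
  rcases le_total (s 1) (s 0) with hs01 | hs01
  · have f1 := mul_le_mul_of_nonneg_left e1 (mul_nonneg hq0.le (sub_nonneg.2 hs01))
    have f2 := mul_le_mul_of_nonneg_left e2 (mul_nonneg (mul_nonneg hp0.le hq0.le) (hs 1))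
    linarith
  · have f1 := mul_le_mul_of_nonneg_left e3 (mul_nonneg hp0.le (sub_nonneg.2 hs01))
    have f2 := mul_le_mul_of_nonneg_left e2 (mul_nonneg (mul_nonneg hp0.le hq0.le) (hs 0))
    linarith

theorem lam_eq_tpqOrder (h : 2 * (p + q) < p * q) (hc : c ≠ 0)
    (hP : P.carrier = newtonDiagram f) (hf : P.initialForm f = tpq p q c) {a b : ℤ}
    {r : Fin 2 → ℝ} (h0 : r 0 = a) (h1 : r 1 = b) :
    2 * p * q * P.lam r = tpqOrder p q a b := by
  rw [lam_eq h hc hP hf r, h0, h1, tpqOrder]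
  push_cast
  rfl

theorem isScaledOrder_tpqOrder (h : 2 * (p + q) < p * q) (hc : c ≠ 0)
    (hP : P.carrier = newtonDiagram f) (hf : P.initialForm f = tpq p q c) :
    P.IsScaledOrder (tpqOrder p q) (P.denom / (2 * p * q)) where
  pos := by
    have := three_le_left_of_lt h
    have := three_le_right_of_lt h
    have := P.denom_pos
    positivity
  denom_mul_lam a b r h0 h1 := by
    have hp : (p : ℝ) ≠ 0 := by have := three_le_left_of_lt h; positivity
    have hq : (q : ℝ) ≠ 0 := by have := three_le_right_of_lt h; positivity
    rw [← lam_eq_tpqOrder h hc hP hf h0 h1]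
    field_simp

/-- An exponent of order at most 2pq has λ_P ≤ 1, the minimum on the support, so there `f` and its
principal part have equal coefficients. -/
theorem sub_tpq_mem_orderFil (h : 2 * (p + q) < p * q) (hc : c ≠ 0)
    (hP : P.carrier = newtonDiagram f) (hf : P.initialForm f = tpq p q c) :
    f - tpq p q c ∈ orderFil K (tpqOrder p q) 0 0 (2 * p * q + 1) := by
  intro α hα
  by_contra hlt
  have hmid := coeff_tpq_middle_ne_zero (p := p) (q := q) hc
  have hmid1 := lam_eq_one_of_eq hP hf hmid
  rw [← hf] at hmid
  refine hα ?_
  rw [map_sub, ← hf, sub_eq_zero]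
  refine (CPolytope.coeff_initialForm_of_lam_le hmid ?_).symm
  have e : (fun j => ((Finsupp.single 0 2 + Finsupp.single 1 2 : Fin 2 →₀ ℕ) j : ℝ)) =
      ![((2 : ℕ) : ℝ), ((2 : ℕ) : ℝ)] := by
    ext j
    fin_cases j <;> simp
  rw [e, hmid1]
  have hD : (0 : ℝ) < 2 * p * q := by
    have := three_le_left_of_lt h
    have := three_le_right_of_lt h
    positivity
  refine le_of_mul_le_mul_left ?_ hD
  rw [lam_eq_tpqOrder h hc hP hf (a := α 0) (b := α 1) (by simp) (by simp), mul_one]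
  rw [sub_zero, sub_zero] at hlt
  have : tpqOrder p q (α 0) (α 1) ≤ 2 * p * q := by omega
  exact_mod_cast this

theorem satisfiesAC_of_initialForm_eq_tpq (h : 2 * (p + q) < p * q) (h2 : (2 : K) ≠ 0) (hc : c ≠ 0)
    (hP : P.carrier = newtonDiagram f) (hf : P.initialForm f = tpq p q c) : P.SatisfiesAC f := by
  have hmem := sub_tpq_mem_orderFil h hc hP hf
  refine CPolytope.satisfiesAC_of_mem_leadingTangent (isPlaneOrder_tpqOrder h)
    (isScaledOrder_tpqOrder h hc hP hf) (d := 2 * p * q) ?_ ?_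
    fun w hw t ht => mem_leadingTangent_of_mem_tjurinaIdeal h h2 hc hmem hw ht
  · simpa using add_mem (orderFil_mono (by linarith) hmem) (tpq_mem_orderFil (c := c) h)
  · intro hf'
    have hcontra : tpq p q c ∈ orderFil K (tpqOrder p q) 0 0 (2 * p * q + 1) := by
      simpa using sub_mem hf' hmem
    have := hcontra _ (coeff_tpq_middle_ne_zero hc)
    rw [single_add_single_apply_zero, single_add_single_apply_one, sub_zero] at this
    push_cast at this
    rw [tpqOrder_two_two h] at this
    linarith

end principalPart

end

end ContactSing

end

theorem corollary5p3 {K : Type*} [Field K] [IsAlgClosed K] (hchar : ringChar K ≠ 2)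
    (p q : ℕ) (hp : 0 < p) (hq : 0 < q) (hpq : (1 : ℝ) / p + 1 / q < 1 / 2)
    (c : K) (hc : c ≠ 0)
    (f : MvPowerSeries (Fin 2) K)
    (P : ContactSing.CPolytope 2) (hP : P.carrier = ContactSing.newtonDiagram f)
    (hf : P.initialForm f = ContactSing.tpq p q c) :
    P.SatisfiesAC f ∧
    ContactSing.ContactEquiv f (ContactSing.tpq p q c) ∧
    ContactSing.HasContactDeterminacy f (max p q) := by
  have h2 : (2 : K) ≠ 0 := Ring.two_ne_zero hchar
  have h : 2 * (p + q) < p * q := by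
    have hp' : (0 : ℝ) < p := by exact_mod_cast hp
    have hq' : (0 : ℝ) < q := by exact_mod_cast hq
    rw [div_add_div _ _ hp'.ne' hq'.ne', div_lt_div_iff₀ (by positivity) two_pos] at hpq
    have : (2 * (p + q) : ℝ) < p * q := by linarith
    exact_mod_cast this
  have hmem := ContactSing.sub_tpq_mem_orderFil h hc hP hf
  exact ⟨ContactSing.satisfiesAC_of_initialForm_eq_tpq h h2 hc hP hf,
    ContactSing.contactEquiv_tpq h h2 hc hmem,
    ContactSing.hasContactDeterminacy_of_sub_tpq_mem h h2 hc hmem⟩
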